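/- **Setting.** Let $I_1,I_2\subset\mathbb R$ with $I_1$ open, let $\Theta\subset\mathbb R$ be an interval, let $a,b\in\Theta$ and $\theta\in\,]a,b[$, and let $(\varphi_t)_{t\in\Theta}$ be a family of real functions on $I_1$. Let $(\varepsilon_n)_{n\ge 0}$ be i.i.d. random variables with values in $I_1$ almost surely, having a density $f$ on $I_1$. Put $X_n=\varphi_\theta(\varepsilon_n)$ and, for $t\in\Theta$, $$Z_n(t)=\varphi_t^{-1}(X_n),\qquad M(t)=\mathbb E\big[|Z_0(t)-\varepsilon_0|^2\big].$$ Write $\partial$ for differentiation in $t\in\Theta$ (one-sided at endpoints of $\Theta$), and $d$ for differentiation in the space variable. Assume: * (A1) for every $t\in\Theta$, $\varphi_t$ is a strictly increasing bijection from $I_1$ onto $I_2$; * (A2) for every $y\in I_2$, $t\mapsto\varphi_t^{-1}(y)$ is continuously differentiable on $\Theta$; * (A3) for every $t\in\Theta$, $\varphi_t^{-1}(\varphi_\theta(\varepsilon_0))\in L^2$; * (A4) for every compact $B\subset\Theta$, $\mathbb E\big[\sup_{t\in B}|\partial\varphi_t^{-1}(\varphi_\theta(\varepsilon_0))|^4\big]<\infty$;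 * (A5) $(t-\theta)M'(t)>0$ for every $t\in[a,b]$ with $t\neq\theta$; * (AD1) $f$ is bounded and twice continuously differentiable on $I_1$, with bounded first and second derivatives; * (AD2) for every $t\in\Theta$, $\varphi_t$ is three times continuously differentiable on $I_1$; * (AD3) $\varphi_\theta^{-1}$ is three times continuously differentiable on $I_2$, with bounded derivatives of orders $1,2,3$; * (AD4) $d\varphi_t(x)$, $d^2\varphi_t(x)$, $d^3\varphi_t(x)$ are bounded over $(t,x)\in\Theta\times I_1$. Let $(\gamma_n)_{n\ge1}$ be a decreasing sequence of positive reals with $\sum_{n\ge1}\gamma_n=+\infty$ and $\sum_{n\ge1}\gamma_n^2<\infty$. Let $\pi_{[a,b]}$ be the projection of $\mathbb R$ onto $[a,b]$, let $\widehat\theta_0\in[a,b]$ be deterministic, and for $n\ge0$ set $$\widehat\theta_{n+1}=\pi_{[a,b]}\big(\widehat\theta_n-\gamma_{n+1}T_{n+1}\big),\qquad T_{n+1}=-2\,\partial\varphi^{-1}_{\widehat\theta_n}(X_{n+1})\big(\varepsilon_{n+1}-\varphi^{-1}_{\widehat\theta_n}(X_{n+1})\big).$$ Let $K:\mathbb R\to[0,\infty)$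 be bounded, symmetric ($K(-u)=K(u)$) and integrable, with $\int_{\mathbb R} K(u)\,du=1$, $\lim_{|u|\to\infty}|u|K(u)=0$ and $\int_{\mathbb R} u^2K(u)\,du<\infty$. Let $0<\alpha<1$ and $h_n=n^{-\alpha}$, and for $n\ge1$ set $$\widehat f_n(x)=\frac1n\sum_{i=1}^n\frac1{h_i}K\!\left(\frac{x-Z_i(\widehat\theta_{i-1})}{h_i}\right).$$ **Theorem.** For every $x\in I_1$, almost surely $\widehat f_n(x)\to f(x)$ as $n\to\infty$. -/

import Mathlib

open MeasureTheory ProbabilityTheory Filter Topology Set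

noncomputable section

/-- The inverse `φ_t⁻¹` of the deformation `φ_t` restricted to `I₁`, evaluated at `y`. For `y` in
`φ_t(I₁)` and `φ_t` injective on `I₁` it is the unique `x ∈ I₁` with `φ_t(x) = y`. -/
def warpInv (φ : ℝ → ℝ → ℝ) (I₁ : Set ℝ) (t y : ℝ) : ℝ :=
  Function.invFunOn (φ t) I₁ y

/-- The derivative `∂φ_t⁻¹(y)` of `φ_t⁻¹(y)` with respect to the parameter `t ∈ Θ`
(one-sided at an endpoint of the interval `Θ`). -/
def warpInvDeriv (φ : ℝ → ℝ → ℝ) (I₁ Θ : Set ℝ) (t y : ℝ) : ℝ :=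
  derivWithin (fun s => warpInv φ I₁ s y) Θ t

/-- The criterion `M(t) = E[|Z(t) - ε|²]`, with `Z(t) = φ_t⁻¹(φ_θ(ε))`. -/
def criterion {Ω : Type*} [MeasurableSpace Ω] (μ : Measure Ω) (φ : ℝ → ℝ → ℝ) (I₁ : Set ℝ)
    (θ : ℝ) (e : Ω → ℝ) (t : ℝ) : ℝ :=
  ∫ ω, |warpInv φ I₁ t (φ θ (e ω)) - e ω| ^ 2 ∂μ

/-- The projection of the real line onto the segment `[a, b]` (for `a ≤ b`). -/
def projSeg (a b x : ℝ) : ℝ := max a (min b x)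

/-- The projected Robbins–Monro estimators `θ̂_n`: the initial value `θ̂_0 = θ₀` is deterministic and
`θ̂_{n+1} = π_{[a,b]}(θ̂_n - γ_{n+1} T_{n+1})`, where `X_{n+1} = φ_θ(ε_{n+1})` and
`T_{n+1} = -2 ∂φ_{θ̂_n}⁻¹(X_{n+1}) (ε_{n+1} - φ_{θ̂_n}⁻¹(X_{n+1}))`. -/
def thetaHat {Ω : Type*} (φ : ℝ → ℝ → ℝ) (I₁ Θ : Set ℝ) (θ a b θ₀ : ℝ) (γ : ℕ → ℝ)
    (ε : ℕ → Ω → ℝ) : ℕ → Ω → ℝ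
  | 0, _ => θ₀
  | n + 1, ω =>
      let t := thetaHat φ I₁ Θ θ a b θ₀ γ ε n ω
      let X := φ θ (ε (n + 1) ω)
      let T := -2 * warpInvDeriv φ I₁ Θ t X * (ε (n + 1) ω - warpInv φ I₁ t X)
      projSeg a b (t - γ (n + 1) * T)

/-- The recursive Parzen–Rosenblatt estimator
`f̂_n(x) = (1/n) ∑_{i=1}^n h_i⁻¹ K((x - Z_i(θ̂_{i-1})) / h_i)` with
`Z_i(t) = φ_t⁻¹(φ_θ(ε_i))` and `h_i = i^{-α}`, for a given sequence of estimators `θ̂`. -/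
def fHat {Ω : Type*} (φ : ℝ → ℝ → ℝ) (I₁ : Set ℝ) (θ : ℝ) (ε : ℕ → Ω → ℝ)
    (thHat : ℕ → Ω → ℝ) (K : ℝ → ℝ) (α : ℝ) (n : ℕ) (x : ℝ) (ω : Ω) : ℝ :=
  (1 / (n : ℝ)) * ∑ i ∈ Finset.Icc 1 n,
    (1 / (i : ℝ) ^ (-α)) *
      K ((x - warpInv φ I₁ (thHat (i - 1) ω) (φ θ (ε i ω))) / (i : ℝ) ^ (-α))

end

/-! Given the past, the `i`-th kernel term is `h⁻¹ K((x - Z) / h)`, where `Z = φ_t⁻¹(φ_θ(ε))` uses a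
fresh `ε` and a parameter `t` determined by the past. The average of these terms splits into
centered innovations plus conditional means, and the two pieces are handled separately.

Innovations. For `t ∈ [a, b]` the variable `Z` has density `warpDensity`, bounded uniformly in `t`,
so a kernel term has conditional second moment `O(1 / h)`. With `h = i^(-α)` and `α < 1`, the series
`∑ 1 / (h i²)` converges. The martingale of innovations divided by `i` is then bounded in `L²` and
converges almost surely (`ae_exists_tendsto_sum_of_centered`), and Kronecker's lemma sends the
averaged innovations to `0`; this is `ae_tendsto_average_of_drift`.

Conditional means. They are kernel smoothings of the density at parameter `θ̂_{i-1}`. Robbins–Monro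
gives `θ̂ → θ` almost surely (`ae_tendsto_thetaHat`): the conditional mean of the gradient step is
`M'`, which points away from `θ`. As `t → θ` and `z → x` jointly, the density at `z` tends to `f x`
(`tendsto_warpDensity`), because `φ_θ⁻¹ ∘ φ_t` tends to the identity together with its derivative.
The approximate-identity lemma `tendsto_integral_rescaled_kernel` then gives the limit `f x`.

Almost surely `ε n ∈ I₁` for all `n`, and only there are the inverses controlled. The argument
therefore runs with versions set to zero off `I₁` and frozen in `t` outside `[a, b]`, which are
jointly measurable, and returns to the original estimators on this event of full measure. -/

namespace ProbabilityTheory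

/-! ### Conditioning on an independent past, and convergence of `L²` martingales. -/

section Freezing

variable {Ω β : Type*} [mΩ : MeasurableSpace Ω] [mβ : MeasurableSpace β] {μ : Measure Ω}
  [IsProbabilityMeasure μ] {X : Ω → β} {Y : Ω → ℝ}

lemma lintegral_enorm_sq_comp_of_indepFun (hX : Measurable X) (hY : Measurable Y)
    (h : IndepFun X Y μ) {G : β × ℝ → ℝ} (hG : Measurable G) :
    ∫⁻ ω, ‖G (X ω, Y ω)‖ₑ ^ 2 ∂μ = ∫⁻ ω, ∫⁻ y, ‖G (X ω, y)‖ₑ ^ 2 ∂(μ.map Y) ∂μ := by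
  have := Measure.isProbabilityMeasure_map (μ := μ) hY.aemeasurable
  have hG2 : Measurable fun p => ‖G p‖ₑ ^ 2 := hG.enorm.pow_const 2
  rw [← lintegral_map (f := fun p => ‖G p‖ₑ ^ 2) (g := fun ω => (X ω, Y ω)) hG2 (hX.prodMk hY),
    (indepFun_iff_map_prod_eq_prod_map_map hX.aemeasurable hY.aemeasurable).1 h,
    lintegral_prod _ hG2.aemeasurable, lintegral_map hG2.lintegral_prod_right' hX]

/-- By Fubini, integrate the fresh variable `Y` first: the factor `W` is then a constant and the
centered factor vanishes. -/
lemma integral_mul_comp_of_indepFun_eq_zero (hX : Measurable X) (hY : Measurable Y)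
    (h : IndepFun X Y μ) {W : β → ℝ} (hW : Measurable W) {G : β × ℝ → ℝ} (hG : Measurable G)
    (hint : Integrable (fun ω => W (X ω) * G (X ω, Y ω)) μ)
    (h0 : ∀ ω, ∫ y, G (X ω, y) ∂(μ.map Y) = 0) :
    ∫ ω, W (X ω) * G (X ω, Y ω) ∂μ = 0 := by
  have := Measure.isProbabilityMeasure_map (μ := μ) hY.aemeasurable
  have := Measure.isProbabilityMeasure_map (μ := μ) hX.aemeasurable
  have hmap := (indepFun_iff_map_prod_eq_prod_map_map hX.aemeasurable hY.aemeasurable).1 h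
  have hXY : Measurable fun ω => (X ω, Y ω) := hX.prodMk hY
  have hF : Measurable fun p : β × ℝ => W p.1 * G p := (hW.comp measurable_fst).mul hG
  have hint' : Integrable (fun p : β × ℝ => W p.1 * G p) ((μ.map X).prod (μ.map Y)) := by
    rw [← hmap]
    exact (integrable_map_measure hF.aestronglyMeasurable hXY.aemeasurable).2 hint
  rw [← integral_map (f := fun p : β × ℝ => W p.1 * G p) hXY.aemeasurable
    hF.aestronglyMeasurable, hmap, integral_prod _ hint',
    integral_map hX.aemeasurable hint'.aestronglyMeasurable.integral_prod_right']
  simp [integral_const_mul, h0]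

lemma measurable_comp_prodMk (hX : Measurable X) (hY : Measurable Y) {G : β × ℝ → ℝ}
    (hG : Measurable G) : Measurable fun ω => G (X ω, Y ω) :=
  hG.comp (hX.prodMk hY)

lemma measurable_indicator_one {s : Set β} (hs : MeasurableSet s) :
    Measurable (s.indicator (1 : β → ℝ)) :=
  measurable_one.indicator hs

end Freezing

variable {Ω : Type*} [mΩ : MeasurableSpace Ω] {μ : Measure Ω}

/-- A σ-algebra `m` is generated by the identity map into `Ω` equipped with `m`. The whole past can
thus play the role of the random variable `X` in the freezing lemmas. -/
lemma indepFun_id_of_indep {m : MeasurableSpace Ω} {Y : Ω → ℝ}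
    (h : Indep (MeasurableSpace.comap Y inferInstance) m μ) :
    @IndepFun Ω Ω ℝ mΩ m inferInstance id Y μ := by
  refine (IndepFun_iff_Indep ..).2 ?_
  rw [MeasurableSpace.comap_id]
  exact h.symm

/-- A series of square integrable innovations `G n ω (Y (n + 1) ω)`, where `G n` only depends on
the past and is centered, converges almost surely as soon as the second moments are summable. -/
theorem ae_exists_tendsto_sum_of_centered [IsProbabilityMeasure μ] {𝓕 : Filtration ℕ mΩ} {Y : ℕ → Ω → ℝ} {P : Measure ℝ}
    (hY : ∀ n, Measurable[𝓕 n] (Y n)) (hlaw : ∀ n, μ.map (Y n) = P)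
    (hind : ∀ n, Indep (MeasurableSpace.comap (Y (n + 1)) inferInstance) (𝓕 n) μ)
    {G : ℕ → Ω → ℝ → ℝ}
    (hG : ∀ n, @Measurable _ _ (@Prod.instMeasurableSpace _ _ (𝓕 n) inferInstance) _
      (Function.uncurry (G n)))
    (h0 : ∀ n ω, ∫ y, G n ω y ∂P = 0) {c : ℕ → ℝ} (hc0 : ∀ n, 0 ≤ c n) (hc : Summable c)
    (hGc : ∀ n ω, ∫⁻ y, ‖G n ω y‖ₑ ^ 2 ∂P ≤ ENNReal.ofReal (c n)) :
    ∀ᵐ ω ∂μ, ∃ l, Tendsto (fun n => ∑ i ∈ Finset.range n, G i ω (Y (i + 1) ω)) atTop (𝓝 l) := by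
  have hYm : ∀ n, Measurable (Y n) := fun n => (hY n).mono (𝓕.le n) le_rfl
  have hid : ∀ n, @Measurable Ω Ω mΩ (𝓕 n) id := fun n => measurable_id'' (𝓕.le n)
  set ξ : ℕ → Ω → ℝ := fun n ω => G n ω (Y (n + 1) ω) with hξ
  set M : ℕ → Ω → ℝ := fun n ω => ∑ i ∈ Finset.range n, ξ i ω with hM
  have hξm : ∀ n, Measurable[𝓕 (n + 1)] (ξ n) := by
    intro n
    exact @measurable_comp_prodMk Ω Ω (𝓕 (n + 1)) (𝓕 n) id (Y (n + 1))
      (measurable_id'' (𝓕.mono n.le_succ)) (hY (n + 1)) (Function.uncurry (G n)) (hG n)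
  have hMm : ∀ n, Measurable[𝓕 n] (M n) := by
    intro n
    refine Finset.measurable_fun_sum _ fun i hi => (hξm i).mono (𝓕.mono ?_) le_rfl
    simpa using hi
  have hξ2 : ∀ n, ∫⁻ ω, ‖ξ n ω‖ₑ ^ 2 ∂μ ≤ ENNReal.ofReal (c n) := by
    intro n
    have := @lintegral_enorm_sq_comp_of_indepFun Ω Ω mΩ (𝓕 n) μ _ id (Y (n + 1)) (hid n) (hYm _)
      (indepFun_id_of_indep (hind n)) (Function.uncurry (G n)) (hG n)
    simp only [id, Function.uncurry_apply_pair, hlaw] at this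
    rw [hξ]
    simp only [this]
    calc _ ≤ ∫⁻ ω, ENNReal.ofReal (c n) ∂μ := lintegral_mono fun ω => hGc n ω
      _ = _ := by simp
  have hξL : ∀ n, MemLp (ξ n) 2 μ := by
    intro n
    refine ⟨((hξm n).mono (𝓕.le _) le_rfl).aestronglyMeasurable, ?_⟩
    rw [eLpNorm_lt_top_iff_lintegral_rpow_enorm_lt_top (by simp) (by simp)]
    simpa using (hξ2 n).trans_lt ENNReal.ofReal_lt_top
  have hML : ∀ n, MemLp (M n) 2 μ := fun n => memLp_finsetSum _ fun i _ => hξL i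
  -- Orthogonality to the past serves twice: `W` an indicator gives the martingale property, and `W
  -- = M n` kills the cross term in `E[M (n + 1) ^ 2]`.
  have horth : ∀ n (W : Ω → ℝ), Measurable[𝓕 n] W → Integrable (fun ω => W ω * ξ n ω) μ →
      ∫ ω, W ω * ξ n ω ∂μ = 0 := by
    intro n W hW hint
    refine @integral_mul_comp_of_indepFun_eq_zero Ω Ω mΩ (𝓕 n) μ _ id (Y (n + 1)) (hid n)
      (hYm _) (indepFun_id_of_indep (hind n)) W hW (Function.uncurry (G n)) (hG n) hint ?_
    intro ω
    simp only [id, Function.uncurry_apply_pair, hlaw, h0]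
  have hmart : Martingale M 𝓕 μ := by
    refine martingale_of_setIntegral_eq_succ (fun n => (hMm n).stronglyMeasurable)
      (fun n => (hML n).integrable one_le_two) ?_
    intro n s hs
    have h1 : ∀ ω, M (n + 1) ω = M n ω + ξ n ω := fun ω => Finset.sum_range_succ _ _
    simp only [h1]
    have hs' := 𝓕.le n s hs
    rw [integral_add ((hML n).integrable one_le_two).integrableOn
      ((hξL n).integrable one_le_two).integrableOn]
    have h2 := horth n (s.indicator 1) (@measurable_indicator_one Ω (𝓕 n) s hs) (by
      have : (fun ω => s.indicator (1 : Ω → ℝ) ω * ξ n ω) = s.indicator (ξ n) := by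
        ext ω; by_cases h : ω ∈ s <;> simp [h]
      rw [this]
      exact ((hξL n).integrable one_le_two).indicator hs')
    have h3 : ∫ ω in s, ξ n ω ∂μ = 0 := by
      rw [← integral_indicator hs', ← h2]
      congr 1
      ext ω; by_cases h : ω ∈ s <;> simp [h]
    rw [h3, add_zero]
  have hM2 : ∀ n, ∫ ω, M n ω ^ 2 ∂μ ≤ ∑ i ∈ Finset.range n, c i := by
    intro n
    induction n with
    | zero => simp [hM]
    | succ n ih =>
      have h1 : ∀ ω, M (n + 1) ω ^ 2 = M n ω ^ 2 + 2 * (M n ω * ξ n ω) + ξ n ω ^ 2 := by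
        intro ω
        have : M (n + 1) ω = M n ω + ξ n ω := Finset.sum_range_succ _ _
        rw [this]; ring
      have hi : Integrable (fun ω => M n ω * ξ n ω) μ := (hML n).integrable_mul (hξL n)
      simp only [h1]
      have hi2 : Integrable (fun ω => M n ω ^ 2 + 2 * (M n ω * ξ n ω)) μ :=
        (hML n).integrable_sq.add (hi.const_mul 2)
      rw [integral_add hi2 (hξL n).integrable_sq, integral_add (hML n).integrable_sq (hi.const_mul 2), integral_const_mul,
        horth n _ (hMm n) hi, Finset.sum_range_succ]
      have h2 : ∫ ω, ξ n ω ^ 2 ∂μ ≤ c n := by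
        rw [integral_eq_lintegral_of_nonneg_ae (ae_of_all _ fun ω => sq_nonneg _)
          (hξL n).integrable_sq.aestronglyMeasurable]
        refine ENNReal.toReal_le_of_le_ofReal (hc0 n) (le_trans (le_of_eq ?_) (hξ2 n))
        congr 1; ext ω
        rw [← Real.enorm_of_nonneg (sq_nonneg _), enorm_pow]
      linarith
  -- Doob's theorem asks for an `L¹` bound, which follows from `|m| ≤ 1 + m²`.
  have hbdd : ∀ n, eLpNorm (M n) 1 μ ≤ ((1 + ∑' i, c i).toNNReal : NNReal) := by
    intro n
    rw [eLpNorm_one_eq_lintegral_enorm, ← ofReal_integral_norm_eq_lintegral_enorm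
      ((hML n).integrable one_le_two)]
    refine ENNReal.ofReal_le_ofReal ?_
    calc ∫ ω, ‖M n ω‖ ∂μ ≤ ∫ ω, (1 + M n ω ^ 2) ∂μ := by
          refine integral_mono ((hML n).integrable one_le_two).norm
            ((integrable_const _).add (hML n).integrable_sq) fun ω => ?_
          simp only [Real.norm_eq_abs]
          nlinarith [sq_abs (M n ω), sq_nonneg (|M n ω| - 1), abs_nonneg (M n ω)]
      _ = 1 + ∫ ω, M n ω ^ 2 ∂μ := by
          rw [integral_add (integrable_const _) (hML n).integrable_sq]; simp
      _ ≤ 1 + ∑' i, c i := by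
          gcongr
          exact (hM2 n).trans (hc.sum_le_tsum _ fun i _ => hc0 i)
  exact hmart.submartingale.exists_ae_tendsto_of_bdd hbdd

end ProbabilityTheory

/-! ### Deterministic lemmas: projection, Kronecker, Robbins–Monro recursion. -/

lemma projSeg_mem {a b : ℝ} (hab : a ≤ b) (x : ℝ) : projSeg a b x ∈ Icc a b :=
  ⟨le_max_left _ _, max_le hab (min_le_left _ _)⟩

lemma projSeg_of_mem {a b x : ℝ} (hx : x ∈ Icc a b) : projSeg a b x = x := by
  rw [projSeg, min_eq_right hx.2, max_eq_right hx.1]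

lemma continuous_projSeg (a b : ℝ) : Continuous (projSeg a b) :=
  continuous_const.max (continuous_const.min continuous_id)

lemma sq_projSeg_sub_le {a b θ : ℝ} (hθ : θ ∈ Icc a b) (x : ℝ) :
    (projSeg a b x - θ) ^ 2 ≤ (x - θ) ^ 2 := by
  obtain ⟨h1, h2⟩ := hθ
  unfold projSeg
  rcases le_total b x with h | h
  · rw [min_eq_left h, max_eq_right (h1.trans h2)]
    nlinarith
  · rw [min_eq_right h]
    rcases le_total a x with h' | h'
    · rw [max_eq_right h']
    · rw [max_eq_left h']
      nlinarith

/-- **Kronecker's lemma** for the weights `n`. -/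
lemma tendsto_inv_mul_sum_of_tendsto_sum {x : ℕ → ℝ} {l : ℝ}
    (h : Tendsto (fun n => ∑ i ∈ Finset.range n, x i) atTop (𝓝 l)) :
    Tendsto (fun n : ℕ => (n : ℝ)⁻¹ * ∑ i ∈ Finset.range n, ((i : ℝ) + 1) * x i)
      atTop (𝓝 0) := by
  -- Summation by parts: after division by `n` this is a partial sum minus the Cesàro mean of the
  -- partial sums, and both have limit `l`.
  have key : ∀ n : ℕ, ∑ i ∈ Finset.range n, ((i : ℝ) + 1) * x i =
      n * ∑ i ∈ Finset.range n, x i -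
        ∑ j ∈ Finset.range n, ∑ i ∈ Finset.range j, x i := by
    intro n
    induction n with
    | zero => simp
    | succ n ih =>
      rw [Finset.sum_range_succ, ih, Finset.sum_range_succ (fun i => x i),
        Finset.sum_range_succ (fun j => ∑ i ∈ Finset.range j, x i)]
      push_cast
      ring
  have h2 := h.sub h.cesaro
  rw [sub_self] at h2
  refine h2.congr' ?_
  filter_upwards [eventually_gt_atTop 0] with n hn
  have : (n : ℝ) ≠ 0 := by positivity
  rw [key]
  field_simp

/-- The deterministic part of the Robbins–Monro argument: a recursive inequality for the squared
distance to `θ` with a drift that is positive away from `θ` forces convergence to `θ`. -/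
lemma tendsto_of_sq_dist_recursion {a b θ : ℝ} {x γ r s : ℕ → ℝ} {w : ℝ → ℝ}
    (hx : ∀ n, x n ∈ Icc a b) (hγ : ∀ n, 0 ≤ γ n)
    (hγs : Tendsto (fun n => ∑ i ∈ Finset.range n, γ i) atTop atTop)
    (hw : ContinuousOn w (Icc a b)) (hwθ : ∀ t ∈ Icc a b, t ≠ θ → 0 < w t)
    (hw0 : ∀ t ∈ Icc a b, 0 ≤ w t)
    (hrec : ∀ n, (x (n + 1) - θ) ^ 2 ≤
      (x n - θ) ^ 2 - 2 * (γ n * w (x n)) - 2 * r n + s n)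
    (hr : ∃ l, Tendsto (fun n => ∑ i ∈ Finset.range n, r i) atTop (𝓝 l)) (hs : Summable s) :
    Tendsto x atTop (𝓝 θ) := by
  obtain ⟨l, hr⟩ := hr
  have hS := hs.hasSum.tendsto_sum_nat
  set R : ℕ → ℝ := fun n => ∑ i ∈ Finset.range n, r i with hR
  set S : ℕ → ℝ := fun n => ∑ i ∈ Finset.range n, s i with hS'
  set W : ℕ → ℝ := fun n => ∑ i ∈ Finset.range n, γ i * w (x i) with hW
  have hRs : ∀ n, R (n + 1) = R n + r n := fun n => Finset.sum_range_succ _ _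
  have hSs : ∀ n, S (n + 1) = S n + s n := fun n => Finset.sum_range_succ _ _
  have hWs : ∀ n, W (n + 1) = W n + γ n * w (x n) := fun n => Finset.sum_range_succ _ _
  have hterm : ∀ n, 0 ≤ γ n * w (x n) := fun n => mul_nonneg (hγ n) (hw0 _ (hx n))
  -- Lyapunov argument: compensating the squared distance by the noise `R`, the remainder `S` and
  -- the accumulated drift `W` makes it nonincreasing. It is bounded below since `R` and `S`
  -- converge, so `W` stays bounded and the squared distance has a limit `v`.
  have hanti : Antitone fun n => (x n - θ) ^ 2 + 2 * R n - S n + 2 * W n := by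
    refine antitone_nat_of_succ_le fun n => ?_
    have := hrec n
    rw [hRs, hSs, hWs]
    linarith
  obtain ⟨B, hB⟩ := (hr.const_mul 2 |>.sub hS).bddBelow_range
  have hBn : ∀ n, B ≤ 2 * R n - S n := fun n => hB ⟨n, rfl⟩
  have hWsum : Summable fun n => γ n * w (x n) := by
    refine summable_of_sum_range_le (c := ((x 0 - θ) ^ 2 - B) / 2) hterm fun n => ?_
    have h1 := hanti (Nat.zero_le n)
    simp only [hR, hS', hW, Finset.range_zero, Finset.sum_empty] at h1
    have h2 := hBn n
    simp only [hR, hS'] at h2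
    nlinarith [sq_nonneg (x n - θ)]
  have hconv : ∃ v, Tendsto (fun n => (x n - θ) ^ 2) atTop (𝓝 v) := by
    have h1 : ∃ u, Tendsto (fun n => (x n - θ) ^ 2 + 2 * R n - S n + 2 * W n) atTop (𝓝 u) := by
      refine ⟨_, tendsto_atTop_ciInf hanti ⟨B, ?_⟩⟩
      rintro _ ⟨n, rfl⟩
      have h2 := hBn n
      have h3 : 0 ≤ W n := Finset.sum_nonneg fun i _ => hterm i
      show B ≤ (x n - θ) ^ 2 + 2 * R n - S n + 2 * W n
      nlinarith [sq_nonneg (x n - θ)]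
    obtain ⟨u, hu⟩ := h1
    refine ⟨_, ((hu.sub (hr.const_mul 2)).add hS).sub
      (hWsum.hasSum.tendsto_sum_nat.const_mul 2) |>.congr fun n => ?_⟩
    simp only [hR, hS', hW]
    ring
  obtain ⟨v, hv⟩ := hconv
  have hv0 : 0 ≤ v := ge_of_tendsto' hv fun n => sq_nonneg _
  suffices hvz : v = 0 by
    rw [hvz] at hv
    have h1 : Tendsto (fun n => |x n - θ|) atTop (𝓝 0) := by
      simpa [Real.sqrt_sq_eq_abs] using hv.sqrt
    exact tendsto_iff_norm_sub_tendsto_zero.2 h1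
  by_contra hne
  have hvpos : 0 < v := lt_of_le_of_ne hv0 (Ne.symm hne)
  have hev : ∀ᶠ n in atTop, v / 2 < (x n - θ) ^ 2 := hv.eventually_const_lt (by linarith)
  -- If `v > 0`, the iterates eventually stay in this compact set, which avoids `θ`. There `w` has a
  -- positive minimum, so summability of `γ n * w (x n)` would force that of `γ`.
  have hcomp : IsCompact (Icc a b ∩ {t | v / 2 ≤ (t - θ) ^ 2}) :=
    isCompact_Icc.inter_right (isClosed_le continuous_const (by fun_prop))
  obtain ⟨n₀, hn₀⟩ := hev.exists
  obtain ⟨t₀, ht₀, hmin⟩ := hcomp.exists_isMinOn ⟨x n₀, hx n₀, hn₀.le⟩ (hw.mono inter_subset_left)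
  have hpos : 0 < w t₀ := by
    refine hwθ t₀ ht₀.1 ?_
    rintro rfl
    have := ht₀.2
    simp only [mem_ofPred_eq, sub_self] at this
    nlinarith
  refine not_summable_iff_tendsto_nat_atTop_of_nonneg hγ |>.2 hγs ?_
  refine summable_of_isBigO_nat hWsum ?_
  refine Asymptotics.IsBigO.of_bound (w t₀)⁻¹ ?_
  filter_upwards [hev] with n hn
  have h1 : w t₀ ≤ w (x n) := hmin ⟨hx n, hn.le⟩
  rw [Real.norm_of_nonneg (hγ n), Real.norm_of_nonneg (hterm n), ← div_eq_inv_mul,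
    le_div_iff₀ hpos]
  exact mul_le_mul_of_nonneg_left h1 (hγ n)

/-! ### Averages of innovations and almost sure Robbins–Monro convergence. -/

namespace ProbabilityTheory

variable {Ω : Type*} [mΩ : MeasurableSpace Ω] {μ : Measure Ω}

section

variable {β : Type*} [MeasurableSpace β]

lemma measurable_uncurry_sub_integral {P : Measure ℝ} [SFinite P] {X : β → ℝ} (hX : Measurable X)
    {g : ℝ → ℝ → ℝ} (hg : Measurable (Function.uncurry g)) :
    Measurable (Function.uncurry fun ω y => g (X ω) y - ∫ e, g (X ω) e ∂P) := by
  refine (hg.comp ((hX.comp measurable_fst).prodMk measurable_snd)).sub ?_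
  have h1 : Measurable fun t => ∫ e, g t e ∂P :=
    (hg.stronglyMeasurable.integral_prod_right (ν := P)).measurable
  exact h1.comp (hX.comp measurable_fst)

end

section Innovations

variable [IsProbabilityMeasure μ] {ε : ℕ → Ω → ℝ} {P : Measure ℝ}
  (hε : ∀ n, Measurable (ε n)) (hind : iIndepFun ε μ) (hlaw : ∀ n, μ.map (ε n) = P)
  {τ : ℕ → Ω → ℝ}
  (hτ : ∀ n, Measurable[Filtration.natural ε (fun n => (hε n).stronglyMeasurable) n] (τ n))

include hε hlaw in
lemma isProbabilityMeasure_of_map_eq : IsProbabilityMeasure P :=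
  hlaw 0 ▸ Measure.isProbabilityMeasure_map (hε 0).aemeasurable

include hind hlaw hτ in
theorem ae_exists_tendsto_sum_sub_integral {g : ℕ → ℝ → ℝ → ℝ}
    (hg : ∀ n, Measurable (Function.uncurry (g n))) {c : ℕ → ℝ} (hc0 : ∀ n, 0 ≤ c n)
    (hc : Summable c)
    (hgc : ∀ n ω, ∫⁻ e, ‖g n (τ n ω) e‖ₑ ^ 2 ∂P ≤ ENNReal.ofReal (c n)) :
    ∀ᵐ ω ∂μ, ∃ l, Tendsto (fun n => ∑ i ∈ Finset.range n,
      (g i (τ i ω) (ε (i + 1) ω) - ∫ e, g i (τ i ω) e ∂P)) atTop (𝓝 l) := by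
  have hP := isProbabilityMeasure_of_map_eq hε hlaw
  have hL : ∀ n ω, MemLp (fun e => g n (τ n ω) e) 2 P := by
    intro n ω
    refine ⟨((hg n).comp measurable_prodMk_left).aestronglyMeasurable, ?_⟩
    rw [eLpNorm_lt_top_iff_lintegral_rpow_enorm_lt_top (by simp) (by simp)]
    simpa using (hgc n ω).trans_lt ENNReal.ofReal_lt_top
  refine ae_exists_tendsto_sum_of_centered
    (𝓕 := Filtration.natural ε fun n => (hε n).stronglyMeasurable) (P := P)
    (G := fun n ω y => g n (τ n ω) y - ∫ e, g n (τ n ω) e ∂P) ?_ hlaw ?_ ?_ ?_ hc0 hc ?_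
  · exact fun n => (Filtration.stronglyAdapted_natural
      (fun n => (hε n).stronglyMeasurable) n).measurable
  · exact fun n => hind.indep_comap_natural_of_lt (fun n => (hε n).stronglyMeasurable)
      n.lt_succ_self
  · exact fun n => @measurable_uncurry_sub_integral Ω
      (Filtration.natural ε (fun n => (hε n).stronglyMeasurable) n) P _ (τ n) (hτ n) (g n) (hg n)
  · intro n ω
    rw [integral_sub ((hL n ω).integrable one_le_two) (integrable_const _)]
    simp
  · intro n ω
    refine le_trans ?_ (hgc n ω)
    -- Centering can only decrease the second moment.
    change evariance (fun e => g n (τ n ω) e) P ≤ _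
    rw [← ofReal_variance (hL n ω)]
    refine (ENNReal.ofReal_le_ofReal (variance_le_expectation_sq
      (hL n ω).aestronglyMeasurable)).trans (le_of_eq ?_)
    simp only [Pi.pow_apply]
    rw [ofReal_integral_eq_lintegral_ofReal (hL n ω).integrable_sq
      (ae_of_all _ fun e => sq_nonneg _)]
    congr 1; ext e
    rw [← Real.enorm_of_nonneg (sq_nonneg _), enorm_pow]

include hind hlaw hτ in
lemma lintegral_enorm_sq_innovation_le {g : ℝ → ℝ → ℝ} (hg : Measurable (Function.uncurry g))
    {n : ℕ} {c : ENNReal} (hgc : ∀ ω, ∫⁻ e, ‖g (τ n ω) e‖ₑ ^ 2 ∂P ≤ c) :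
    ∫⁻ ω, ‖g (τ n ω) (ε (n + 1) ω)‖ₑ ^ 2 ∂μ ≤ c := by
  have h1 : IndepFun (τ n) (ε (n + 1)) μ := by
    refine (IndepFun_iff_Indep ..).2 ?_
    exact indep_of_indep_of_le_left (hind.indep_comap_natural_of_lt
      (fun n => (hε n).stronglyMeasurable) n.lt_succ_self).symm (hτ n).comap_le
  have h2 := lintegral_enorm_sq_comp_of_indepFun
    ((hτ n).mono (Filtration.le _ n) le_rfl) (hε (n + 1)) h1 hg
  simp only [Function.uncurry_apply_pair, hlaw] at h2
  rw [h2]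
  calc _ ≤ ∫⁻ ω, c ∂μ := lintegral_mono hgc
    _ = c := by simp

include hind hlaw hτ in
/-- A strong law of large numbers for averages of innovations with converging drift. -/
theorem ae_tendsto_average_of_drift {g : ℕ → ℝ → ℝ → ℝ}
    (hg : ∀ n, Measurable (Function.uncurry (g n))) {c : ℕ → ℝ} (hc0 : ∀ n, 0 ≤ c n)
    (hc : Summable fun n : ℕ => c n / ((n : ℝ) + 1) ^ 2)
    (hgc : ∀ n ω, ∫⁻ e, ‖g n (τ n ω) e‖ₑ ^ 2 ∂P ≤ ENNReal.ofReal (c n)) {l : ℝ}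
    (hl : ∀ᵐ ω ∂μ, Tendsto (fun n => ∫ e, g n (τ n ω) e ∂P) atTop (𝓝 l)) :
    ∀ᵐ ω ∂μ, Tendsto (fun n : ℕ =>
      (n : ℝ)⁻¹ * ∑ i ∈ Finset.range n, g i (τ i ω) (ε (i + 1) ω)) atTop (𝓝 l) := by
  -- The weights `1 / (n + 1)` are those required by Kronecker's lemma; they turn the variance bound
  -- into `c n / (n + 1) ^ 2`. The conditional means are averaged separately by Cesàro.
  have h1 := ae_exists_tendsto_sum_sub_integral hε hind hlaw hτ
    (g := fun n t e => ((n : ℝ) + 1)⁻¹ * g n t e) (fun n => (hg n).const_mul _)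
    (c := fun n => c n / ((n : ℝ) + 1) ^ 2) (fun n => div_nonneg (hc0 n) (sq_nonneg _)) hc ?_
  · filter_upwards [h1, hl] with ω ⟨s, hs⟩ hω
    have h2 := (tendsto_inv_mul_sum_of_tendsto_sum hs).add hω.cesaro
    rw [zero_add] at h2
    refine h2.congr fun n => ?_
    rw [← mul_add, ← Finset.sum_add_distrib]
    congr 1
    refine Finset.sum_congr rfl fun i _ => ?_
    have : ((i : ℝ) + 1) ≠ 0 := by positivity
    rw [integral_const_mul]
    field_simp
    ring
  · intro n ω
    simp only [enorm_mul, mul_pow]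
    rw [lintegral_const_mul' _ _ (by simp)]
    calc _ ≤ ‖((n : ℝ) + 1)⁻¹‖ₑ ^ 2 * ENNReal.ofReal (c n) := by gcongr; exact hgc n ω
      _ = _ := by
        rw [← enorm_pow, Real.enorm_of_nonneg (sq_nonneg _), ← ENNReal.ofReal_mul (sq_nonneg _)]
        congr 1
        rw [inv_pow, div_eq_inv_mul]

end Innovations

/-- **Robbins–Monro**: almost sure convergence of the projected stochastic approximation scheme
with i.i.d. innovations. -/
theorem ae_tendsto_robbinsMonro [IsProbabilityMeasure μ] {ε : ℕ → Ω → ℝ} {P : Measure ℝ}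
    (hε : ∀ n, Measurable (ε n)) (hind : iIndepFun ε μ) (hlaw : ∀ n, μ.map (ε n) = P)
    {a b θ : ℝ} (hθ : θ ∈ Icc a b) {γ : ℕ → ℝ} (hγ : ∀ n, 0 ≤ γ (n + 1))
    (hγs : Tendsto (fun n => ∑ i ∈ Finset.range n, γ (i + 1)) atTop atTop)
    (hγ2 : Summable fun n => γ (n + 1) ^ 2)
    {H : ℝ → ℝ → ℝ} (hH : Measurable (Function.uncurry H)) {C : ℝ} (hC : 0 ≤ C)
    (hHC : ∀ t ∈ Icc a b, ∫⁻ e, ‖H t e‖ₑ ^ 2 ∂P ≤ ENNReal.ofReal C)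
    (hm : ContinuousOn (fun t => ∫ e, H t e ∂P) (Icc a b))
    (hm0 : ∀ t ∈ Icc a b, t ≠ θ → 0 < (t - θ) * ∫ e, H t e ∂P)
    {τ : ℕ → Ω → ℝ}
    (hτm : ∀ n, Measurable[Filtration.natural ε (fun n => (hε n).stronglyMeasurable) n] (τ n))
    (hτ : ∀ n ω, τ n ω ∈ Icc a b)
    (hrec : ∀ n ω, τ (n + 1) ω =
      projSeg a b (τ n ω - γ (n + 1) * H (τ n ω) (ε (n + 1) ω))) :
    ∀ᵐ ω ∂μ, Tendsto (fun n => τ n ω) atTop (𝓝 θ) := by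
  -- This is the noise in the cross term when the square of `τ n - θ - γ H` is expanded; the
  -- constant uses `|τ n - θ| ≤ b - a`.
  have h1 := ae_exists_tendsto_sum_sub_integral hε hind hlaw hτm
    (g := fun n t e => γ (n + 1) * (t - θ) * H t e)
    (fun n => ((measurable_fst.sub_const θ).const_mul _).mul hH)
    (c := fun n => γ (n + 1) ^ 2 * ((b - a) ^ 2 * C)) (fun n => by positivity)
    (hγ2.mul_right _) ?_
  -- The quadratic term needs no martingale: the expectation of the nonnegative series is at most `C
  -- * ∑ γ²`, so the series is almost surely finite.
  · have h2 : ∀ᵐ ω ∂μ, Summable fun n => γ (n + 1) ^ 2 * H (τ n ω) (ε (n + 1) ω) ^ 2 := by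
      have hHm : ∀ n, Measurable fun ω => H (τ n ω) (ε (n + 1) ω) := fun n =>
        hH.comp (((hτm n).mono (Filtration.le _ n) le_rfl).prodMk (hε (n + 1)))
      have hmeas : ∀ n, Measurable fun ω =>
          ENNReal.ofReal (γ (n + 1) ^ 2 * H (τ n ω) (ε (n + 1) ω) ^ 2) := fun n =>
        (((hHm n).pow_const 2).const_mul _).ennreal_ofReal
      have hfin : ∫⁻ ω, ∑' n, ENNReal.ofReal (γ (n + 1) ^ 2 * H (τ n ω) (ε (n + 1) ω) ^ 2) ∂μ
          ≠ ⊤ := by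
        rw [lintegral_tsum fun n => (hmeas n).aemeasurable]
        refine ne_top_of_le_ne_top (hγ2.mul_right C).tsum_ofReal_ne_top
          (ENNReal.tsum_le_tsum fun n => ?_)
        simp only [ENNReal.ofReal_mul (sq_nonneg (γ (n + 1)))]
        rw [lintegral_const_mul' _ _ ENNReal.ofReal_ne_top]
        gcongr
        refine le_trans (le_of_eq ?_) (lintegral_enorm_sq_innovation_le hε hind hlaw hτm hH
          (n := n) fun ω => hHC _ (hτ n ω))
        congr 1; ext ω
        rw [← Real.enorm_of_nonneg (sq_nonneg _), enorm_pow]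
      have := ae_lt_top' (AEMeasurable.tsum fun n => (hmeas n).aemeasurable) hfin
      filter_upwards [this] with ω hω
      have h3 := ENNReal.summable_toReal hω.ne
      refine h3.congr fun n => ?_
      rw [ENNReal.toReal_ofReal (by positivity)]
    filter_upwards [h1, h2] with ω hω1 hω2
    refine tendsto_of_sq_dist_recursion (x := fun n => τ n ω) (γ := fun n => γ (n + 1))
      (w := fun t => (t - θ) * ∫ e, H t e ∂P) (fun n => hτ n ω) hγ hγs
      ((continuousOn_id.sub continuousOn_const).mul hm) hm0 ?_ ?_ hω1 hω2
    · intro t ht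
      rcases eq_or_ne t θ with rfl | h
      · simp
      · exact (hm0 t ht h).le
    · intro n
      have h3 := sq_projSeg_sub_le hθ (τ n ω - γ (n + 1) * H (τ n ω) (ε (n + 1) ω))
      rw [hrec n ω, integral_const_mul]
      refine h3.trans (le_of_eq ?_)
      ring
  · intro n ω
    have h4 : ∀ e, ‖γ (n + 1) * (τ n ω - θ) * H (τ n ω) e‖ₑ ^ 2 =
        ENNReal.ofReal ((γ (n + 1) * (τ n ω - θ)) ^ 2) * ‖H (τ n ω) e‖ₑ ^ 2 := fun e => by
      rw [enorm_mul, mul_pow, ← enorm_pow, Real.enorm_of_nonneg (sq_nonneg _)]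
    simp only [h4]
    rw [lintegral_const_mul' _ _ ENNReal.ofReal_ne_top]
    calc _ ≤ ENNReal.ofReal (γ (n + 1) ^ 2 * (b - a) ^ 2) * ENNReal.ofReal C := by
          gcongr
          · rw [mul_pow]
            refine mul_le_mul_of_nonneg_left ?_ (sq_nonneg _)
            obtain ⟨h5, h6⟩ := hτ n ω
            obtain ⟨h7, h8⟩ := hθ
            exact sq_le_sq' (by linarith) (by linarith)
          · exact hHC _ (hτ n ω)
      _ = _ := by
        rw [← ENNReal.ofReal_mul (by positivity)]
        congr 1; ring

end ProbabilityTheory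

/-! ### Monotone maps and limits of functions with bounded derivatives. -/

lemma StrictMonoOn.isOpen_image_of_continuousOn {g : ℝ → ℝ} {U : Set ℝ} (hU : IsOpen U)
    (hg : StrictMonoOn g U) (hc : ContinuousOn g U) : IsOpen (g '' U) := by
  rw [isOpen_iff_mem_nhds]
  rintro _ ⟨x, hx, rfl⟩
  obtain ⟨δ, hδ, hball⟩ := Metric.nhds_basis_closedBall.mem_iff.1 (hU.mem_nhds hx)
  rw [Real.closedBall_eq_Icc] at hball
  have h1 : x - δ ∈ U := hball ⟨le_rfl, by linarith⟩
  have h2 : x + δ ∈ U := hball ⟨by linarith, le_rfl⟩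
  refine mem_of_superset (Icc_mem_nhds (hg h1 hx (by linarith)) (hg hx h2 (by linarith))) ?_
  exact (intermediate_value_Icc (by linarith) (hc.mono hball)).trans (image_mono hball)

lemma hasDerivAt_and_bounds_of_contDiffOn {g : ℝ → ℝ} {U : Set ℝ} (hU : IsOpen U)
    (hg : ContDiffOn ℝ 3 g U) {C : ℝ}
    (hC : ∀ x ∈ U, ∀ k : ℕ, 1 ≤ k → k ≤ 3 → |iteratedDerivWithin k g U x| ≤ C) :
    (∀ x ∈ U, HasDerivAt g (deriv g x) x ∧ |deriv g x| ≤ C) ∧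
      (∀ x ∈ U, DifferentiableAt ℝ (deriv g) x ∧ |deriv (deriv g) x| ≤ C) := by
  refine ⟨fun x hx => ⟨?_, ?_⟩, fun x hx => ⟨?_, ?_⟩⟩
  · exact ((hg.contDiffAt (hU.mem_nhds hx)).differentiableAt (by norm_num)).hasDerivAt
  · have := hC x hx 1 le_rfl (by norm_num)
    rwa [iteratedDerivWithin_of_isOpen hU hx, iteratedDeriv_one] at this
  · have h1 : ContDiffOn ℝ 2 (deriv g) U := hg.deriv_of_isOpen hU (by norm_num)
    exact (h1.contDiffAt (hU.mem_nhds hx)).differentiableAt (by norm_num)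
  · have := hC x hx 2 (by norm_num) (by norm_num)
    rwa [iteratedDerivWithin_of_isOpen hU hx, iteratedDeriv_succ, iteratedDeriv_one] at this

section UniformLimits

variable {ι : Type*} {l : Filter ι} {u : ι → ℝ → ℝ} {v : ℝ → ℝ} {U : Set ℝ} {C x : ℝ} {z : ι → ℝ}

/-- Pointwise convergence of functions with uniformly bounded derivatives is locally uniform. -/
lemma tendsto_apply_of_deriv_bound (hU : IsOpen U) (hx : x ∈ U)
    (hu : ∀ i, ∀ y ∈ U, DifferentiableAt ℝ (u i) y ∧ |deriv (u i) y| ≤ C)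
    (hv : Tendsto (fun i => u i x) l (𝓝 (v x))) (hz : Tendsto z l (𝓝 x)) :
    Tendsto (fun i => u i (z i)) l (𝓝 (v x)) := by
  obtain ⟨δ, hδ, hball⟩ := Metric.isOpen_iff.1 hU x hx
  have h1 : Tendsto (fun i => C * ‖z i - x‖) l (𝓝 0) := by
    simpa using (tendsto_iff_norm_sub_tendsto_zero.1 hz).const_mul C
  have h2 : Tendsto (fun i => u i (z i) - u i x) l (𝓝 0) := by
    refine squeeze_zero_norm' ?_ h1
    filter_upwards [hz (Metric.ball_mem_nhds x hδ)] with i hi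
    exact (convex_ball x δ).norm_image_sub_le_of_norm_deriv_le
      (fun y hy => (hu i y (hball hy)).1) (fun y hy => (hu i y (hball hy)).2)
      (Metric.mem_ball_self hδ) hi
  simpa using h2.add hv

/-- Pointwise convergence of functions with uniformly bounded second derivatives entails locally
uniform convergence of the first derivatives. -/
lemma tendsto_deriv_apply_of_deriv_bound (hU : IsOpen U) (hx : x ∈ U)
    (hu : ∀ i, ∀ y ∈ U, DifferentiableAt ℝ (u i) y)
    (hu2 : ∀ i, ∀ y ∈ U, DifferentiableAt ℝ (deriv (u i)) y ∧ |deriv (deriv (u i)) y| ≤ C)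
    (hv : DifferentiableAt ℝ v x)
    (huv : ∀ y ∈ U, Tendsto (fun i => u i y) l (𝓝 (v y))) (hz : Tendsto z l (𝓝 x)) :
    Tendsto (fun i => deriv (u i) (z i)) l (𝓝 (deriv v x)) := by
  rcases l.eq_or_neBot with rfl | hl
  · simp
  obtain ⟨i₀⟩ := hl.nonempty
  have hC : 0 ≤ C := (abs_nonneg _).trans (hu2 i₀ x hx).2
  obtain ⟨δ, hδ, hball⟩ := Metric.isOpen_iff.1 hU x hx
  rw [Metric.tendsto_nhds]
  intro η hη
  have hslope : ∀ᶠ s in 𝓝[>] (0 : ℝ), |s⁻¹ * (v (x + s) - v x) - deriv v x| < η / 4 := by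
    have h1 := hv.hasDerivAt.tendsto_slope_zero_right
    simpa [Real.dist_eq] using Metric.tendsto_nhds.1 h1 (η / 4) (by linarith)
  have hsmall : ∀ᶠ s in 𝓝[>] (0 : ℝ), s < δ ∧ C * s < η / 4 := by
    have h1 : Tendsto (fun s : ℝ => C * s) (𝓝[>] 0) (𝓝 0) := by
      have : Tendsto (fun s : ℝ => C * s) (𝓝 0) (𝓝 (C * 0)) := tendsto_id.const_mul C
      rw [mul_zero] at this
      exact this.mono_left nhdsWithin_le_nhds
    exact ((eventually_lt_nhds hδ).filter_mono nhdsWithin_le_nhds).and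
      (h1.eventually_lt_const (by linarith))
  -- The step `s` is fixed before `i`. Four errors of size `η / 4` add up: from `z i` to `x` and
  -- from `x` to the mean value point `ζ` (Lipschitz derivative), from the quotient of `u i` to that
  -- of `v`, and from the latter to `deriv v x`.
  obtain ⟨s, hs1, ⟨hs2, hs3⟩, hs0⟩ := (hslope.and (hsmall.and self_mem_nhdsWithin)).exists
  replace hs0 : 0 < s := hs0
  have hsub : Icc x (x + s) ⊆ Metric.ball x δ := fun y hy => by
    rw [Metric.mem_ball, Real.dist_eq, abs_of_nonneg (by linarith [hy.1])]
    linarith [hy.2]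
  have hq : ∀ᶠ i in l, |s⁻¹ * (u i (x + s) - u i x) - s⁻¹ * (v (x + s) - v x)| < η / 4 := by
    have h1 := ((huv _ (hball (hsub ⟨by linarith, le_rfl⟩))).sub (huv x hx)).const_mul s⁻¹
    simpa [Real.dist_eq] using Metric.tendsto_nhds.1 h1 (η / 4) (by linarith)
  have hzs : ∀ᶠ i in l, |z i - x| < s := by
    simpa [Real.dist_eq] using Metric.tendsto_nhds.1 hz s hs0
  have hzC : ∀ᶠ i in l, C * |z i - x| < η / 4 := by
    have h1 := (tendsto_iff_norm_sub_tendsto_zero.1 hz).const_mul C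
    rw [mul_zero] at h1
    exact h1.eventually_lt_const (by linarith)
  filter_upwards [hq, hzs, hzC] with i h1 h2 h3
  obtain ⟨ζ, hζ, hζ'⟩ := exists_deriv_eq_slope (u i) (show x < x + s by linarith)
    (fun y hy => (hu i y (hball (hsub hy))).continuousAt.continuousWithinAt)
    (fun y hy => (hu i y (hball (hsub ⟨hy.1.le, hy.2.le⟩))).differentiableWithinAt)
  have h4 : deriv (u i) ζ = s⁻¹ * (u i (x + s) - u i x) := by
    rw [hζ', add_sub_cancel_left, div_eq_inv_mul]
  have hlip : ∀ y ∈ Metric.ball x δ, |deriv (u i) y - deriv (u i) x| ≤ C * |y - x| :=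
    fun y hy => (convex_ball x δ).norm_image_sub_le_of_norm_deriv_le
      (fun y hy => (hu2 i y (hball hy)).1) (fun y hy => (hu2 i y (hball hy)).2)
      (Metric.mem_ball_self hδ) hy
  have h5 := hlip ζ (hsub ⟨hζ.1.le, hζ.2.le⟩)
  have h6 := hlip (z i) (by rw [Metric.mem_ball, Real.dist_eq]; linarith)
  have h7 : C * |ζ - x| ≤ C * s := by
    refine mul_le_mul_of_nonneg_left ?_ hC
    rw [abs_of_nonneg (by linarith [hζ.1])]
    linarith [hζ.2]
  rw [h4] at h5
  rw [Real.dist_eq]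
  rw [abs_lt] at *
  rw [abs_le] at h5 h6
  constructor <;> linarith [h5.1, h5.2, h6.1, h6.2, h1.1, h1.2, hs1.1, hs1.2, h3, hs3]

end UniformLimits

/-! ### The deformations, their inverses, and the density of `φ_t⁻¹(φ_θ(ε))`. -/

section Warp

variable {φ : ℝ → ℝ → ℝ} {I₁ I₂ Θ : Set ℝ} {t x y θ : ℝ}

lemma warpInv_mem (h : BijOn (φ t) I₁ I₂) (hy : y ∈ I₂) : warpInv φ I₁ t y ∈ I₁ :=
  h.surjOn.mapsTo_invFunOn hy

lemma apply_warpInv (h : BijOn (φ t) I₁ I₂) (hy : y ∈ I₂) : φ t (warpInv φ I₁ t y) = y :=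
  h.surjOn.rightInvOn_invFunOn hy

lemma warpInv_apply (h : BijOn (φ t) I₁ I₂) (hx : x ∈ I₁) : warpInv φ I₁ t (φ t x) = x :=
  h.injOn.leftInvOn_invFunOn hx

lemma warpInv_lt_iff (h : BijOn (φ t) I₁ I₂) (hm : StrictMonoOn (φ t) I₁) (hy : y ∈ I₂)
    (hx : x ∈ I₁) : warpInv φ I₁ t y < x ↔ y < φ t x := by
  rw [← hm.lt_iff_lt (warpInv_mem h hy) hx, apply_warpInv h hy]

lemma lt_warpInv_iff (h : BijOn (φ t) I₁ I₂) (hm : StrictMonoOn (φ t) I₁) (hy : y ∈ I₂)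
    (hx : x ∈ I₁) : x < warpInv φ I₁ t y ↔ φ t x < y := by
  rw [← hm.lt_iff_lt hx (warpInv_mem h hy), apply_warpInv h hy]

lemma warpInv_mono (h : BijOn (φ t) I₁ I₂) (hm : StrictMonoOn (φ t) I₁) :
    MonotoneOn (warpInv φ I₁ t) I₂ := by
  intro y hy y' hy' hyy
  rwa [← hm.le_iff_le (warpInv_mem h hy) (warpInv_mem h hy'), apply_warpInv h hy,
    apply_warpInv h hy']

/-- Continuity in the parameter of the inverse deformations passes to the deformations. -/
lemma tendsto_warp_of_continuousOn (hI₂ : IsOpen I₂)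
    (hA1 : ∀ t ∈ Θ, BijOn (φ t) I₁ I₂ ∧ StrictMonoOn (φ t) I₁)
    (hc : ∀ y ∈ I₂, ContinuousOn (fun t => warpInv φ I₁ t y) Θ) (hθ : θ ∈ Θ) (hx : x ∈ I₁) :
    Tendsto (fun t => φ t x) (𝓝[Θ] θ) (𝓝 (φ θ x)) := by
  obtain ⟨hb, hm⟩ := hA1 θ hθ
  have hnhds := hI₂.mem_nhds (hb.mapsTo hx)
  rw [tendsto_order]
  constructor
  · intro c hc'
    -- For a fixed intermediate level `y`, the inequality `y < φ_t(x)` is equivalent to `φ_t⁻¹(y) <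
    -- x`, which persists for `t` near `θ` by continuity of the inverse in `t`.
    obtain ⟨y, hy, hcy, hyx⟩ : ∃ y ∈ I₂, c < y ∧ y < φ θ x := by
      have h1 : ∀ᶠ y in 𝓝[<] (φ θ x), y ∈ I₂ ∧ c < y :=
        ((show ∀ᶠ y in 𝓝 (φ θ x), y ∈ I₂ from hnhds).and (eventually_gt_nhds hc')).filter_mono
          nhdsWithin_le_nhds
      obtain ⟨y, ⟨h2, h3⟩, h4⟩ := (h1.and self_mem_nhdsWithin).exists
      exact ⟨y, h2, h3, h4⟩
    have h1 := (hc y hy θ hθ).eventually_lt_const ((warpInv_lt_iff hb hm hy hx).2 hyx)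
    filter_upwards [h1, self_mem_nhdsWithin] with t ht htΘ
    exact hcy.trans ((warpInv_lt_iff (hA1 t htΘ).1 (hA1 t htΘ).2 hy hx).1 ht)
  · intro c hc'
    obtain ⟨y, hy, hcy, hyx⟩ : ∃ y ∈ I₂, y < c ∧ φ θ x < y := by
      have h1 : ∀ᶠ y in 𝓝[>] (φ θ x), y ∈ I₂ ∧ y < c :=
        ((show ∀ᶠ y in 𝓝 (φ θ x), y ∈ I₂ from hnhds).and (eventually_lt_nhds hc')).filter_mono
          nhdsWithin_le_nhds
      obtain ⟨y, ⟨h2, h3⟩, h4⟩ := (h1.and self_mem_nhdsWithin).exists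
      exact ⟨y, h2, h3, h4⟩
    have h1 := (hc y hy θ hθ).eventually_const_lt ((lt_warpInv_iff hb hm hy hx).2 hyx)
    filter_upwards [h1, self_mem_nhdsWithin] with t ht htΘ
    exact ((lt_warpInv_iff (hA1 t htΘ).1 (hA1 t htΘ).2 hy hx).1 ht).trans hcy

/-- The density of `φ_t⁻¹(φ_θ(ε))` when `ε` has density `f` on `I₁`. -/
noncomputable def warpDensity (φ : ℝ → ℝ → ℝ) (I₁ : Set ℝ) (f : ℝ → ℝ) (θ t : ℝ) : ℝ → ℝ :=
  I₁.indicator fun z =>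
    |deriv (warpInv φ I₁ θ) (φ t z) * deriv (φ t) z| * f (warpInv φ I₁ θ (φ t z))

variable {f : ℝ → ℝ}

lemma warpDensity_nonneg (hθ : BijOn (φ θ) I₁ I₂) (ht : BijOn (φ t) I₁ I₂)
    (hf : ∀ x ∈ I₁, 0 ≤ f x) (z : ℝ) : 0 ≤ warpDensity φ I₁ f θ t z :=
  indicator_nonneg (fun _ hz => mul_nonneg (abs_nonneg _)
    (hf _ (warpInv_mem hθ (ht.mapsTo hz)))) z

lemma warpDensity_le (hθ : BijOn (φ θ) I₁ I₂) (ht : BijOn (φ t) I₁ I₂) {A B D : ℝ}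
    (hf : ∀ x ∈ I₁, 0 ≤ f x) (hfA : ∀ x ∈ I₁, f x ≤ A)
    (hB : ∀ y ∈ I₂, |deriv (warpInv φ I₁ θ) y| ≤ B) (hD : ∀ x ∈ I₁, |deriv (φ t) x| ≤ D) (z : ℝ) :
    warpDensity φ I₁ f θ t z ≤ |B| * |D| * |A| := by
  unfold warpDensity
  by_cases hz : z ∈ I₁
  · rw [indicator_of_mem hz, abs_mul]
    have h1 := hf _ (warpInv_mem hθ (ht.mapsTo hz))
    have h2 := (hfA _ (warpInv_mem hθ (ht.mapsTo hz))).trans (le_abs_self A)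
    have h3 := (hB _ (ht.mapsTo hz)).trans (le_abs_self B)
    have h4 := (hD z hz).trans (le_abs_self D)
    gcongr
  · rw [indicator_of_notMem hz]
    positivity

lemma measurable_warpDensity (hI₁ : IsOpen I₁) (hI₂ : IsOpen I₂) (hθ : BijOn (φ θ) I₁ I₂)
    (ht : BijOn (φ t) I₁ I₂) (hfc : ContinuousOn f I₁) (hφ : ContDiffOn ℝ 3 (φ t) I₁)
    (hw : ContDiffOn ℝ 3 (warpInv φ I₁ θ) I₂) : Measurable (warpDensity φ I₁ f θ t) := by
  have hφc := hφ.continuousOn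
  have h1 : ContinuousOn (deriv (φ t)) I₁ := hφ.continuousOn_deriv_of_isOpen hI₁ (by norm_num)
  have h2 : ContinuousOn (deriv (warpInv φ I₁ θ)) I₂ :=
    hw.continuousOn_deriv_of_isOpen hI₂ (by norm_num)
  have h3 : ContinuousOn (fun z =>
      |deriv (warpInv φ I₁ θ) (φ t z) * deriv (φ t) z| * f (warpInv φ I₁ θ (φ t z))) I₁ := by
    refine ContinuousOn.mul ?_ ?_
    · exact ((h2.comp hφc ht.mapsTo).mul h1).abs
    · exact hfc.comp (hw.continuousOn.comp hφc ht.mapsTo)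
        fun z hz => warpInv_mem hθ (ht.mapsTo hz)
  classical
  rw [warpDensity, ← piecewise_eq_indicator]
  exact h3.measurable_piecewise continuousOn_const hI₁.measurableSet

lemma image_warpInv_comp (hθ : BijOn (φ θ) I₁ I₂) (ht : BijOn (φ t) I₁ I₂) :
    (fun z => warpInv φ I₁ θ (φ t z)) '' I₁ = I₁ := by
  refine Subset.antisymm ?_ fun e he => ?_
  · rintro _ ⟨z, hz, rfl⟩
    exact warpInv_mem hθ (ht.mapsTo hz)
  · refine ⟨warpInv φ I₁ t (φ θ e), warpInv_mem ht (hθ.mapsTo he), ?_⟩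
    simp only [apply_warpInv ht (hθ.mapsTo he), warpInv_apply hθ he]

/-- Change of variables: the law of `φ_t⁻¹(φ_θ(ε))` has density `warpDensity`. -/
lemma lintegral_warpInv_eq (hI₁ : IsOpen I₁) (hI₂ : IsOpen I₂) (hθ : BijOn (φ θ) I₁ I₂)
    (ht : BijOn (φ t) I₁ I₂) (hφ : ContDiffOn ℝ 3 (φ t) I₁)
    (hw : ContDiffOn ℝ 3 (warpInv φ I₁ θ) I₂)
    {F : ℝ → ENNReal} :
    ∫⁻ e in I₁, ENNReal.ofReal (f e) * F (warpInv φ I₁ t (φ θ e)) =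
      ∫⁻ z, ENNReal.ofReal (warpDensity φ I₁ f θ t z) * F z := by
  -- The substitution is `e = φ_θ⁻¹(φ_t(z))`, a bijection of `I₁` onto itself whose inverse is `e ↦
  -- φ_t⁻¹(φ_θ(e))`.
  have hder : ∀ z ∈ I₁, HasDerivWithinAt (fun z => warpInv φ I₁ θ (φ t z))
      (deriv (warpInv φ I₁ θ) (φ t z) * deriv (φ t) z) I₁ z := fun z hz =>
    (((hw.contDiffAt (hI₂.mem_nhds (ht.mapsTo hz))).differentiableAt (by norm_num)).hasDerivAt.comp
      z ((hφ.contDiffAt (hI₁.mem_nhds hz)).differentiableAt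
        (by norm_num)).hasDerivAt).hasDerivWithinAt
  have hinj : InjOn (fun z => warpInv φ I₁ θ (φ t z)) I₁ := fun z hz z' hz' h => by
    have := congrArg (φ θ) h
    simp only [apply_warpInv hθ (ht.mapsTo hz), apply_warpInv hθ (ht.mapsTo hz')] at this
    exact ht.injOn hz hz' this
  have h1 := lintegral_image_eq_lintegral_abs_deriv_mul hI₁.measurableSet hder hinj
    (fun e => ENNReal.ofReal (f e) * F (warpInv φ I₁ t (φ θ e)))
  rw [image_warpInv_comp hθ ht] at h1
  rw [h1, ← lintegral_indicator hI₁.measurableSet]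
  congr 1; ext z
  by_cases hz : z ∈ I₁
  · simp only [indicator_of_mem hz, warpDensity]
    rw [apply_warpInv hθ (ht.mapsTo hz), warpInv_apply ht hz, ENNReal.ofReal_mul (abs_nonneg _),
      mul_assoc]
  · simp [indicator_of_notMem hz, warpDensity]

/-- Joint continuity at `(θ, x)` of the densities, where `warpDensity` equals `f`. -/
lemma tendsto_warpDensity {ι : Type*} {l : Filter ι} {s : ι → ℝ} {z : ι → ℝ} (hI₁ : IsOpen I₁)
    (hI₂ : IsOpen I₂) (hA1 : ∀ t ∈ Θ, BijOn (φ t) I₁ I₂ ∧ StrictMonoOn (φ t) I₁)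
    (hc : ∀ y ∈ I₂, ContinuousOn (fun t => warpInv φ I₁ t y) Θ) (hθ : θ ∈ Θ) (hx : x ∈ I₁)
    (hfc : ContinuousOn f I₁) (hφ : ∀ t ∈ Θ, ContDiffOn ℝ 3 (φ t) I₁)
    (hw : ContDiffOn ℝ 3 (warpInv φ I₁ θ) I₂) {C : ℝ}
    (hC : ∀ t ∈ Θ, ∀ x ∈ I₁, ∀ k : ℕ, 1 ≤ k → k ≤ 3 → |iteratedDerivWithin k (φ t) I₁ x| ≤ C)
    (hsΘ : ∀ i, s i ∈ Θ) (hs : Tendsto s l (𝓝 θ)) (hz : Tendsto z l (𝓝 x)) :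
    Tendsto (fun i => warpDensity φ I₁ f θ (s i) (z i)) l (𝓝 (f x)) := by
  have hB := fun t ht => hasDerivAt_and_bounds_of_contDiffOn hI₁ (hφ t ht) (hC t ht)
  have hpt : ∀ y ∈ I₁, Tendsto (fun i => φ (s i) y) l (𝓝 (φ θ y)) := fun y hy =>
    (tendsto_warp_of_continuousOn hI₂ hA1 hc hθ hy).comp
      (tendsto_nhdsWithin_iff.2 ⟨hs, Eventually.of_forall hsΘ⟩)
  have h1 : Tendsto (fun i => φ (s i) (z i)) l (𝓝 (φ θ x)) :=
    tendsto_apply_of_deriv_bound (u := fun i => φ (s i)) (v := φ θ) hI₁ hx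
      (fun i y hy => ⟨((hB _ (hsΘ i)).1 y hy).1.differentiableAt, ((hB _ (hsΘ i)).1 y hy).2⟩)
      (hpt x hx) hz
  have h2 : Tendsto (fun i => deriv (φ (s i)) (z i)) l (𝓝 (deriv (φ θ) x)) :=
    tendsto_deriv_apply_of_deriv_bound (u := fun i => φ (s i)) (v := φ θ) hI₁ hx
      (fun i y hy => ((hB _ (hsΘ i)).1 y hy).1.differentiableAt)
      (fun i => (hB _ (hsΘ i)).2) ((hB _ hθ).1 x hx).1.differentiableAt hpt hz
  have hb := (hA1 θ hθ).1
  have hy := hb.mapsTo hx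
  have h3 : Tendsto (fun i => deriv (warpInv φ I₁ θ) (φ (s i) (z i))) l
      (𝓝 (deriv (warpInv φ I₁ θ) (φ θ x))) :=
    ((hw.continuousOn_deriv_of_isOpen hI₂ (by norm_num)).continuousAt
      (hI₂.mem_nhds hy)).tendsto.comp h1
  have h4 : Tendsto (fun i => f (warpInv φ I₁ θ (φ (s i) (z i)))) l (𝓝 (f x)) := by
    have h5 := (hw.continuousOn.continuousAt (hI₂.mem_nhds hy)).tendsto.comp h1
    rw [warpInv_apply hb hx] at h5
    exact (hfc.continuousAt (hI₁.mem_nhds hx)).tendsto.comp h5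
  -- Differentiating `φ_θ⁻¹ ∘ φ_θ = id` shows that the Jacobian factor tends to `1`.
  have hone : deriv (warpInv φ I₁ θ) (φ θ x) * deriv (φ θ) x = 1 := by
    have h6 := ((hw.contDiffAt (hI₂.mem_nhds hy)).differentiableAt
      (by norm_num)).hasDerivAt.comp x ((hB _ hθ).1 x hx).1
    have h7 : (warpInv φ I₁ θ ∘ φ θ) =ᶠ[𝓝 x] id := by
      filter_upwards [hI₁.mem_nhds hx] with z hz using warpInv_apply hb hz
    exact (h6.congr_of_eventuallyEq h7.symm).unique (hasDerivAt_id x)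
  have h8 := (h3.mul h2).abs.mul h4
  rw [hone, abs_one, one_mul] at h8
  refine h8.congr' ?_
  filter_upwards [hz (hI₁.mem_nhds hx)] with i hi
  simp only [warpDensity]
  rw [indicator_of_mem (show z i ∈ I₁ from hi)]

end Warp

/-- Approximate identities: the rescaled kernel smoothing of bounded functions `ρ i` that converge
continuously at `x` converges to the limit value. -/
lemma tendsto_integral_rescaled_kernel {ι : Type*} {l : Filter ι} [l.IsCountablyGenerated]
    {K : ℝ → ℝ} (hKint : Integrable K) (hK1 : ∫ u, K u = 1) {ρ : ι → ℝ → ℝ} {B x v : ℝ}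
    (hρm : ∀ i, Measurable (ρ i)) (hρB : ∀ i z, |ρ i z| ≤ B) {h : ι → ℝ} (h0 : ∀ i, 0 < h i)
    (hh : Tendsto h l (𝓝 0))
    (hρ : ∀ z : ι → ℝ, Tendsto z l (𝓝 x) → Tendsto (fun i => ρ i (z i)) l (𝓝 v)) :
    Tendsto (fun i => ∫ z, ρ i z * (1 / h i * K ((x - z) / h i))) l (𝓝 v) := by
  have hcv : ∀ i, ∫ z, ρ i z * (1 / h i * K ((x - z) / h i)) = ∫ u, ρ i (x - h i * u) * K u := by
    intro i
    have hne := (h0 i).ne'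
    have h1 := integral_sub_left_eq_self
      (fun w => ρ i (x - w) * (1 / h i * K (w / h i))) (volume : Measure ℝ) x
    simp only [sub_sub_cancel] at h1
    rw [h1]
    have h2 := Measure.integral_comp_div (fun u => ρ i (x - h i * u) * (1 / h i * K u)) (h i)
    have h3 : ∀ w, h i * (w / h i) = w := fun w => by field_simp
    simp only [h3] at h2
    rw [h2, abs_of_pos (h0 i), smul_eq_mul, ← integral_const_mul]
    congr 1; ext u
    field_simp
  simp only [hcv]
  -- After the substitution `z = x - h i * u`, the functions `ρ i` are evaluated at points moving to
  -- `x`; this is why convergence along every `z i → x` is assumed.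
  have hlim : Tendsto (fun i => ∫ u, ρ i (x - h i * u) * K u) l (𝓝 (∫ u, v * K u)) := by
    refine tendsto_integral_filter_of_dominated_convergence (fun u => B * ‖K u‖) ?_ ?_
      (hKint.norm.const_mul B) ?_
    · exact Eventually.of_forall fun i =>
        ((hρm i).comp (by fun_prop)).aestronglyMeasurable.mul hKint.aestronglyMeasurable
    · refine Eventually.of_forall fun i => ae_of_all _ fun u => ?_
      rw [norm_mul]
      exact mul_le_mul_of_nonneg_right (hρB i _) (norm_nonneg _)
    · refine ae_of_all _ fun u => (hρ _ ?_).mul_const _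
      simpa using (hh.mul_const u).const_sub x
  rwa [integral_const_mul, hK1, mul_one] at hlim

/-! ### The quadratic criterion and its stochastic gradient. -/

section QuadraticCriterion

variable {P : Measure ℝ} {a b θ : ℝ} {z d : ℝ → ℝ → ℝ} {S : ℝ → ℝ}

/-- The stochastic gradient of the quadratic criterion `E[(z t e - e) ^ 2]`. -/
def quadGrad (z d : ℝ → ℝ → ℝ) (t e : ℝ) : ℝ := -2 * d t e * (e - z t e)

/-- Mean value inequality in the parameter, started at `θ` where the error vanishes. Hence the
gradient is `O(S²)`, and its second moment is controlled by the fourth moment of `S`. -/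
lemma abs_sub_le_of_hasDerivWithinAt {t e : ℝ} (hθ : θ ∈ Icc a b)
    (hder : ∀ t ∈ Icc a b, HasDerivWithinAt (fun s => z s e) (d t e) (Icc a b) t)
    (hS : ∀ t ∈ Icc a b, |d t e| ≤ S e) (h0 : z θ e = e) (ht : t ∈ Icc a b) :
    |z t e - e| ≤ (b - a) * S e := by
  have h1 := (convex_Icc a b).norm_image_sub_le_of_norm_hasDerivWithin_le hder hS hθ ht
  rw [h0, Real.norm_eq_abs, Real.norm_eq_abs] at h1
  refine h1.trans ?_
  rw [mul_comm]
  refine mul_le_mul_of_nonneg_right ?_ ((abs_nonneg _).trans (hS t ht))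
  obtain ⟨h2, h3⟩ := hθ
  obtain ⟨h4, h5⟩ := ht
  exact abs_le.2 ⟨by linarith, by linarith⟩

lemma abs_quadGrad_le {t e : ℝ} (hθ : θ ∈ Icc a b)
    (hder : ∀ t ∈ Icc a b, HasDerivWithinAt (fun s => z s e) (d t e) (Icc a b) t)
    (hS : ∀ t ∈ Icc a b, |d t e| ≤ S e) (h0 : z θ e = e) (ht : t ∈ Icc a b) :
    |quadGrad z d t e| ≤ 2 * (b - a) * S e ^ 2 := by
  have h1 := abs_sub_le_of_hasDerivWithinAt hθ hder hS h0 ht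
  have h2 := hS t ht
  rw [quadGrad, abs_mul, abs_mul, abs_sub_comm, abs_neg, abs_two]
  calc 2 * |d t e| * |z t e - e| ≤ 2 * S e * ((b - a) * S e) := by
        have := (abs_nonneg _).trans h2
        gcongr
    _ = _ := by ring

lemma hasDerivWithinAt_sq_sub {t e : ℝ}
    (hder : HasDerivWithinAt (fun s => z s e) (d t e) (Icc a b) t) :
    HasDerivWithinAt (fun s => (z s e - e) ^ 2) (quadGrad z d t e) (Icc a b) t := by
  have h1 := (hder.sub_const e).pow 2
  refine h1.congr_deriv ?_
  simp only [quadGrad, Nat.cast_ofNat]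
  ring

/-- The derivative is a pointwise limit of measurable difference quotients; `a < b` ensures that `t`
is an accumulation point of `[a, b]`. -/
lemma measurable_of_hasDerivWithinAt (hab : a < b) (hzm : ∀ t, Measurable (z t))
    {t : ℝ} (ht : t ∈ Icc a b)
    (hder : ∀ e, HasDerivWithinAt (fun s => z s e) (d t e) (Icc a b) t) : Measurable (d t) := by
  have hne : (𝓝[Icc a b \ {t}] t).NeBot := by
    rw [sdiff_eq, inter_comm, nhdsWithin_inter']
    exact (uniqueDiffOn_Icc hab t ht).accPt
  refine measurable_of_tendsto_metrizable' (𝓝[Icc a b \ {t}] t)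
    (f := fun s e => slope (fun s => z s e) t s) (fun s => ?_) ?_
  · simp only [slope_def_module]
    exact ((hzm s).sub (hzm t)).const_mul (s - t)⁻¹
  · exact tendsto_pi_nhds.2 fun e => hasDerivWithinAt_iff_tendsto_slope.1 (hder e)

variable (hθ : θ ∈ Icc a b) (hzm : ∀ t, Measurable (z t)) (hdm : ∀ t, Measurable (d t))
  (hder : ∀ e, ∀ t ∈ Icc a b, HasDerivWithinAt (fun s => z s e) (d t e) (Icc a b) t)
  (hS : ∀ e, ∀ t ∈ Icc a b, |d t e| ≤ S e) (h0 : ∀ᵐ e ∂P, z θ e = e)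
  (hSm : Measurable S)

include hSm in
lemma memLp_sq_of_lintegral_pow_four (hS4 : ∫⁻ e, ‖S e‖ₑ ^ 4 ∂P ≠ ⊤) :
    MemLp (fun e => S e ^ 2) 2 P := by
  refine ⟨(hSm.pow_const 2).aestronglyMeasurable, ?_⟩
  rw [eLpNorm_lt_top_iff_lintegral_rpow_enorm_lt_top (by simp) (by simp)]
  refine lt_of_le_of_lt (le_of_eq ?_) (lt_top_iff_ne_top.2 hS4)
  congr 1; ext e
  rw [enorm_pow]
  norm_num [← pow_mul]

include hθ hder hS h0 in
lemma lintegral_enorm_sq_quadGrad_le {t : ℝ} (ht : t ∈ Icc a b) :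
    ∫⁻ e, ‖quadGrad z d t e‖ₑ ^ 2 ∂P ≤
      ENNReal.ofReal ((2 * (b - a)) ^ 2) * ∫⁻ e, ‖S e‖ₑ ^ 4 ∂P := by
  rw [← lintegral_const_mul' _ _ ENNReal.ofReal_ne_top]
  refine lintegral_mono_ae ?_
  filter_upwards [h0] with e he
  have h1 := abs_quadGrad_le hθ (hder e) (hS e) he ht
  rw [← enorm_pow, ← enorm_pow, Real.enorm_of_nonneg (sq_nonneg _),
    Real.enorm_of_nonneg (by positivity), ← ENNReal.ofReal_mul (sq_nonneg _)]
  refine ENNReal.ofReal_le_ofReal ?_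
  rw [← sq_abs]
  refine (pow_le_pow_left₀ (abs_nonneg _) h1 2).trans (le_of_eq ?_)
  ring

include hθ hzm hdm hder hS h0 hSm in
lemma continuousOn_integral_quadGrad [IsFiniteMeasure P] (hS4 : ∫⁻ e, ‖S e‖ₑ ^ 4 ∂P ≠ ⊤)
    (hzc : ∀ e, ContinuousOn (fun t => z t e) (Icc a b))
    (hdc : ∀ e, ContinuousOn (fun t => d t e) (Icc a b)) :
    ContinuousOn (fun t => ∫ e, quadGrad z d t e ∂P) (Icc a b) := by
  refine continuousOn_of_dominated (bound := fun e => 2 * (b - a) * S e ^ 2) ?_ ?_ ?_ ?_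
  · intro t _
    exact (((hdm t).const_mul _).mul (measurable_id.sub (hzm t))).aestronglyMeasurable
  · intro t ht
    filter_upwards [h0] with e he using abs_quadGrad_le hθ (hder e) (hS e) he ht
  · exact ((memLp_sq_of_lintegral_pow_four hSm hS4).integrable one_le_two).const_mul _
  · exact ae_of_all _ fun e =>
      (continuousOn_const.mul (hdc e)).mul (continuousOn_const.sub (hzc e))

include hθ hzm hder hS h0 hSm in
/-- Differentiation of the quadratic criterion under the integral sign. -/
lemma hasDerivWithinAt_integral_sq_sub [IsFiniteMeasure P] (hS4 : ∫⁻ e, ‖S e‖ₑ ^ 4 ∂P ≠ ⊤)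
    {t : ℝ} (ht : t ∈ Icc a b) :
    HasDerivWithinAt (fun t => ∫ e, (z t e - e) ^ 2 ∂P) (∫ e, quadGrad z d t e ∂P)
      (Icc a b) t := by
  have hSi : Integrable (fun e => S e ^ 2) P :=
    (memLp_sq_of_lintegral_pow_four hSm hS4).integrable one_le_two
  have hm : ∀ s, Measurable fun e => (z s e - e) ^ 2 := fun s =>
    ((hzm s).sub measurable_id).pow_const 2
  have hint : ∀ s ∈ Icc a b, Integrable (fun e => (z s e - e) ^ 2) P := by
    intro s hs
    refine (hSi.const_mul ((b - a) ^ 2)).mono' (hm s).aestronglyMeasurable ?_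
    filter_upwards [h0] with e he
    have h1 := abs_sub_le_of_hasDerivWithinAt hθ (hder e) (hS e) he hs
    rw [Real.norm_of_nonneg (sq_nonneg _), ← mul_pow, ← sq_abs]
    exact pow_le_pow_left₀ (abs_nonneg _) h1 2
  rw [hasDerivWithinAt_iff_tendsto_slope]
  have hev : ∀ᶠ s in 𝓝[Icc a b \ {t}] t, s ∈ Icc a b \ {t} := self_mem_nhdsWithin
  have h1 : Tendsto (fun s => ∫ e, slope (fun s => (z s e - e) ^ 2) t s ∂P)
      (𝓝[Icc a b \ {t}] t) (𝓝 (∫ e, quadGrad z d t e ∂P)) := by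
    refine tendsto_integral_filter_of_dominated_convergence
      (fun e => 2 * (b - a) * S e ^ 2) ?_ ?_ (hSi.const_mul _) ?_
    · refine Eventually.of_forall fun s => ?_
      simp only [slope_def_module]
      exact (((hm s).sub (hm t)).const_mul (s - t)⁻¹).aestronglyMeasurable
    · filter_upwards [hev] with s hs
      filter_upwards [h0] with e he
      -- The mean value inequality makes the integrable bound on the gradient dominate all the
      -- difference quotients.
      have h2 := (convex_Icc a b).norm_image_sub_le_of_norm_hasDerivWithin_le
        (fun s hs => hasDerivWithinAt_sq_sub (hder e s hs))
        (fun s hs => abs_quadGrad_le hθ (hder e) (hS e) he hs) ht hs.1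
      have h3 : 0 < ‖s - t‖ := norm_pos_iff.2 (sub_ne_zero.2 hs.2)
      rw [slope_def_module, norm_smul, norm_inv, inv_mul_le_iff₀ h3, mul_comm]
      exact h2
    · exact ae_of_all _ fun e =>
        hasDerivWithinAt_iff_tendsto_slope.1 (hasDerivWithinAt_sq_sub (hder e t ht))
  refine h1.congr' ?_
  filter_upwards [hev] with s hs
  simp only [slope_def_module, smul_eq_mul]
  rw [integral_const_mul, integral_sub (hint s hs.1) (hint t ht)]

end QuadraticCriterion

lemma iSup_eq_iSup_rat_of_continuous {g : ℝ → ENNReal} (hg : Continuous g) :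
    ⨆ t, g t = ⨆ q : ℚ, g q := by
  refine le_antisymm (iSup_le fun t => ?_) (iSup_le fun q => le_iSup g (q : ℝ))
  exact Rat.denseRange_cast.induction_on (p := fun t => g t ≤ ⨆ q : ℚ, g q) t
    (isClosed_le hg continuous_const) fun q => le_iSup (fun q : ℚ => g q) q

/-! ### Jointly measurable versions of the inverse deformation and its derivative. -/

section ClippedInverse

variable {φ : ℝ → ℝ → ℝ} {I₁ I₂ Θ : Set ℝ} {a b θ : ℝ}

/-- The map `(t, e) ↦ φ_t⁻¹(φ_θ(e))`, extended by zero outside `I₁` and constantly in `t` outside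
`[a, b]`. -/
noncomputable def clippedInv (φ : ℝ → ℝ → ℝ) (I₁ : Set ℝ) (θ a b t : ℝ) : ℝ → ℝ :=
  I₁.indicator fun e => warpInv φ I₁ (projSeg a b t) (φ θ e)

/-- The derivative `∂φ_t⁻¹(φ_θ(e))`, extended in the same way as `clippedInv`. -/
noncomputable def clippedInvDeriv (φ : ℝ → ℝ → ℝ) (I₁ Θ : Set ℝ) (θ a b t : ℝ) : ℝ → ℝ :=
  I₁.indicator fun e => warpInvDeriv φ I₁ Θ (projSeg a b t) (φ θ e)

/-- The supremum over `t ∈ [a, b]` of `|∂φ_t⁻¹(φ_θ(e))|`. -/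
noncomputable def clippedInvDerivSup (φ : ℝ → ℝ → ℝ) (I₁ Θ : Set ℝ) (θ a b e : ℝ) : ENNReal :=
  ⨆ t, ‖clippedInvDeriv φ I₁ Θ θ a b t e‖ₑ

lemma clippedInv_eq {t e : ℝ} (ht : t ∈ Icc a b) (he : e ∈ I₁) :
    clippedInv φ I₁ θ a b t e = warpInv φ I₁ t (φ θ e) := by
  rw [clippedInv, indicator_of_mem he, projSeg_of_mem ht]

lemma clippedInvDeriv_eq {t e : ℝ} (ht : t ∈ Icc a b) (he : e ∈ I₁) :
    clippedInvDeriv φ I₁ Θ θ a b t e = warpInvDeriv φ I₁ Θ t (φ θ e) := by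
  rw [clippedInvDeriv, indicator_of_mem he, projSeg_of_mem ht]

variable (hab : a < b) (hI₁ : IsOpen I₁) (hΘ : UniqueDiffOn ℝ Θ) (hsub : Icc a b ⊆ Θ) (hθ : θ ∈ Θ)
  (hA1 : ∀ t ∈ Θ, BijOn (φ t) I₁ I₂ ∧ StrictMonoOn (φ t) I₁)
  (hA2 : ∀ y ∈ I₂, ContDiffOn ℝ 1 (fun t => warpInv φ I₁ t y) Θ)

include hab hsub hθ hA1 hA2 in
-- Continuity on the whole line, combined with measurability in `e`, yields joint measurability of a
-- Carathéodory function.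
lemma continuous_clippedInv (e : ℝ) : Continuous fun t => clippedInv φ I₁ θ a b t e := by
  by_cases he : e ∈ I₁
  · simp only [clippedInv, indicator_of_mem he]
    exact ((hA2 _ ((hA1 θ hθ).1.mapsTo he)).continuousOn.comp_continuous (continuous_projSeg a b)
      fun t => hsub (projSeg_mem hab.le t))
  · simp only [clippedInv, indicator_of_notMem he]
    exact continuous_const

include hab hΘ hsub hθ hA1 hA2 in
lemma continuous_clippedInvDeriv (e : ℝ) :
    Continuous fun t => clippedInvDeriv φ I₁ Θ θ a b t e := by
  by_cases he : e ∈ I₁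
  · simp only [clippedInvDeriv, indicator_of_mem he]
    have h1 := (hA2 _ ((hA1 θ hθ).1.mapsTo he)).continuousOn_derivWithin hΘ le_rfl
    exact h1.comp_continuous (continuous_projSeg a b) fun t => hsub (projSeg_mem hab.le t)
  · simp only [clippedInvDeriv, indicator_of_notMem he]
    exact continuous_const

include hsub hθ hA1 hA2 in
lemma hasDerivWithinAt_clippedInv (e : ℝ) {t : ℝ} (ht : t ∈ Icc a b) :
    HasDerivWithinAt (fun s => clippedInv φ I₁ θ a b s e) (clippedInvDeriv φ I₁ Θ θ a b t e)
      (Icc a b) t := by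
  by_cases he : e ∈ I₁
  · rw [clippedInvDeriv_eq ht he]
    have h1 := ((hA2 _ ((hA1 θ hθ).1.mapsTo he)).differentiableOn one_ne_zero t
      (hsub ht)).hasDerivWithinAt.mono hsub
    exact h1.congr (fun s hs => clippedInv_eq hs he) (clippedInv_eq ht he)
  · simp only [clippedInv, clippedInvDeriv, indicator_of_notMem he]
    exact hasDerivWithinAt_const _ _ _

include hab hI₁ hsub hθ hA1 in
lemma measurable_clippedInv (t : ℝ) : Measurable (clippedInv φ I₁ θ a b t) := by
  have ht := hA1 _ (hsub (projSeg_mem hab.le t))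
  have hθ' := hA1 θ hθ
  refine measurable_of_restrict_of_restrict_compl hI₁.measurableSet ?_ ?_
  -- On `I₁` the map is a composition of increasing maps.
  · refine Monotone.measurable fun e e' hee => ?_
    simp only [clippedInv, domRestrict_apply, indicator_of_mem e.2, indicator_of_mem e'.2]
    exact warpInv_mono ht.1 ht.2 (hθ'.1.mapsTo e.2) (hθ'.1.mapsTo e'.2)
      (hθ'.2.monotoneOn e.2 e'.2 hee)
  · have : I₁ᶜ.domRestrict (clippedInv φ I₁ θ a b t) = fun _ => 0 := by
      ext e
      simp only [clippedInv, domRestrict_apply, indicator_of_notMem e.2]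
    rw [this]
    exact measurable_const

include hab hI₁ hsub hθ hA1 hA2 in
lemma measurable_clippedInvDeriv (t : ℝ) : Measurable (clippedInvDeriv φ I₁ Θ θ a b t) := by
  have h1 : clippedInvDeriv φ I₁ Θ θ a b t = clippedInvDeriv φ I₁ Θ θ a b (projSeg a b t) := by
    rw [clippedInvDeriv, clippedInvDeriv, projSeg_of_mem (projSeg_mem hab.le t)]
  rw [h1]
  exact measurable_of_hasDerivWithinAt hab (measurable_clippedInv hab hI₁ hsub hθ hA1)
    (projSeg_mem hab.le t)
    fun e => hasDerivWithinAt_clippedInv hsub hθ hA1 hA2 e (projSeg_mem hab.le t)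

include hab hI₁ hΘ hsub hθ hA1 hA2 in
-- Continuity in `t` reduces the supremum to rational parameters, hence to a countable one.
lemma measurable_clippedInvDerivSup : Measurable (clippedInvDerivSup φ I₁ Θ θ a b) := by
  have : clippedInvDerivSup φ I₁ Θ θ a b =
      fun e => ⨆ q : ℚ, ‖clippedInvDeriv φ I₁ Θ θ a b q e‖ₑ := by
    ext e
    exact iSup_eq_iSup_rat_of_continuous
      (continuous_clippedInvDeriv hab hΘ hsub hθ hA1 hA2 e).enorm
  rw [this]
  exact .iSup fun q => (measurable_clippedInvDeriv hab hI₁ hsub hθ hA1 hA2 q).enorm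

include hab hΘ hsub hθ hA1 hA2 in
lemma clippedInvDerivSup_ne_top (e : ℝ) : clippedInvDerivSup φ I₁ Θ θ a b e ≠ ⊤ := by
  obtain ⟨B, hB⟩ := isCompact_Icc.exists_bound_of_continuousOn
    (continuous_clippedInvDeriv hab hΘ hsub hθ hA1 hA2 e).continuousOn (s := Icc a b)
  refine ne_top_of_le_ne_top (ENNReal.ofReal_ne_top (r := B)) (iSup_le fun t => ?_)
  have h1 : clippedInvDeriv φ I₁ Θ θ a b t = clippedInvDeriv φ I₁ Θ θ a b (projSeg a b t) := by
    rw [clippedInvDeriv, clippedInvDeriv, projSeg_of_mem (projSeg_mem hab.le t)]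
  rw [h1, ← ofReal_norm]
  exact ENNReal.ofReal_le_ofReal (hB _ (projSeg_mem hab.le t))

include hab in
lemma clippedInvDerivSup_pow_four_le (e : ℝ) :
    clippedInvDerivSup φ I₁ Θ θ a b e ^ 4 ≤
      ⨆ t ∈ Icc a b, ‖warpInvDeriv φ I₁ Θ t (φ θ e)‖ₑ ^ 4 := by
  rw [clippedInvDerivSup, ENNReal.iSup_pow]
  refine iSup_le fun t => ?_
  by_cases he : e ∈ I₁
  · rw [clippedInvDeriv, indicator_of_mem he]
    exact le_iSup₂ (f := fun t _ => ‖warpInvDeriv φ I₁ Θ t (φ θ e)‖ₑ ^ 4) (projSeg a b t)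
      (projSeg_mem hab.le t)
  · simp [clippedInvDeriv, indicator_of_notMem he]

end ClippedInverse

/-- The projected stochastic approximation scheme with gradient `H`. -/
noncomputable def projIter {Ω : Type*} (a b θ₀ : ℝ) (γ : ℕ → ℝ) (H : ℝ → ℝ → ℝ)
    (ε : ℕ → Ω → ℝ) : ℕ → Ω → ℝ
  | 0, _ => θ₀
  | n + 1, ω => projSeg a b (projIter a b θ₀ γ H ε n ω -
      γ (n + 1) * H (projIter a b θ₀ γ H ε n ω) (ε (n + 1) ω))

section ProjIter

variable {Ω : Type*} {a b θ₀ : ℝ} {γ : ℕ → ℝ} {H : ℝ → ℝ → ℝ} {ε : ℕ → Ω → ℝ}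

lemma projIter_mem (hθ₀ : θ₀ ∈ Icc a b) (n : ℕ) (ω : Ω) :
    projIter a b θ₀ γ H ε n ω ∈ Icc a b := by
  cases n with
  | zero => exact hθ₀
  | succ n => exact projSeg_mem (hθ₀.1.trans hθ₀.2) _

lemma measurable_projIter_step {m m' : MeasurableSpace Ω} (hm : m ≤ m')
    (hH : Measurable (Function.uncurry H)) {τ Y : Ω → ℝ} (hτ : Measurable[m] τ)
    (hY : Measurable[m'] Y) (c : ℝ) :
    Measurable[m'] fun ω => projSeg a b (τ ω - c * H (τ ω) (Y ω)) := by
  have hτ' : Measurable[m'] τ := hτ.mono hm le_rfl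
  exact (continuous_projSeg a b).measurable.comp
    (hτ'.sub ((hH.comp (hτ'.prodMk hY)).const_mul c))

lemma measurable_projIter [MeasurableSpace Ω] (hε : ∀ n, Measurable (ε n))
    (hH : Measurable (Function.uncurry H)) (n : ℕ) :
    Measurable[Filtration.natural ε (fun n => (hε n).stronglyMeasurable) n]
      (projIter a b θ₀ γ H ε n) := by
  induction n with
  | zero => exact measurable_const
  | succ n ih =>
    exact measurable_projIter_step ((Filtration.natural ε _).mono n.le_succ) hH ih
      (Filtration.stronglyAdapted_natural (fun n => (hε n).stronglyMeasurable) (n + 1)).measurable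
      (γ (n + 1))

end ProjIter

/-- The iterates stay in `[a, b]` and the innovations lie in `I₁`, so the clipping is never felt. -/
lemma projIter_eq_thetaHat {Ω : Type*} {φ : ℝ → ℝ → ℝ} {I₁ Θ : Set ℝ} {θ a b θ₀ : ℝ} {γ : ℕ → ℝ}
    {ε : ℕ → Ω → ℝ} (hθ₀ : θ₀ ∈ Icc a b) {ω : Ω} (hω : ∀ n, ε n ω ∈ I₁) (n : ℕ) :
    projIter a b θ₀ γ (quadGrad (clippedInv φ I₁ θ a b) (clippedInvDeriv φ I₁ Θ θ a b)) ε n ω =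
      thetaHat φ I₁ Θ θ a b θ₀ γ ε n ω := by
  induction n with
  | zero => rfl
  | succ n ih =>
    have h1 := projIter_mem (γ := γ) (ε := ε)
      (H := quadGrad (clippedInv φ I₁ θ a b) (clippedInvDeriv φ I₁ Θ θ a b)) hθ₀ n ω
    rw [projIter, thetaHat, quadGrad, clippedInv_eq h1 (hω _), clippedInvDeriv_eq h1 (hω _), ih]

/-! ### Rescaled kernels and the law of the inverse. -/

section RescaledKernel

variable {K : ℝ → ℝ} {x h : ℝ}

lemma integral_rescaled_kernel (hh : 0 < h) (hK1 : ∫ u, K u = 1) :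
    ∫ z, 1 / h * K ((x - z) / h) = 1 := by
  rw [integral_sub_left_eq_self (fun w => 1 / h * K (w / h)) volume x, integral_const_mul,
    Measure.integral_comp_div, hK1, abs_of_pos hh, smul_eq_mul, mul_one, one_div_mul_cancel hh.ne']

lemma integrable_rescaled_kernel (hh : 0 < h) (hK : Integrable K) :
    Integrable fun z => 1 / h * K ((x - z) / h) :=
  ((hK.comp_div hh.ne').comp_sub_left x).const_mul _

/-- Bound one factor of the square by `A / h`; the other has integral one. -/
lemma lintegral_rescaled_kernel_sq_le (hh : 0 < h) (hK : Integrable K) (hK0 : ∀ u, 0 ≤ K u)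
    (hK1 : ∫ u, K u = 1) {A : ℝ} (hA : ∀ u, K u ≤ A) :
    ∫⁻ z, ‖1 / h * K ((x - z) / h)‖ₑ ^ 2 ≤ ENNReal.ofReal (A / h) := by
  have hA0 : 0 ≤ A := (hK0 0).trans (hA 0)
  calc ∫⁻ z, ‖1 / h * K ((x - z) / h)‖ₑ ^ 2
      ≤ ∫⁻ z, ENNReal.ofReal (A / h) * ENNReal.ofReal (1 / h * K ((x - z) / h)) := by
        refine lintegral_mono fun z => ?_
        have h1 := hK0 ((x - z) / h)
        rw [← enorm_pow, Real.enorm_of_nonneg (sq_nonneg _), ← ENNReal.ofReal_mul (by positivity),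
          sq]
        refine ENNReal.ofReal_le_ofReal (mul_le_mul_of_nonneg_right ?_ (by positivity))
        rw [div_mul_eq_mul_div, one_mul]
        exact div_le_div_of_nonneg_right (hA _) hh.le
    _ = ENNReal.ofReal (A / h) := by
        rw [lintegral_const_mul' _ _ ENNReal.ofReal_ne_top,
          ← ofReal_integral_eq_lintegral_ofReal (integrable_rescaled_kernel hh hK)
            (ae_of_all _ fun z => mul_nonneg (by positivity) (hK0 _)),
          integral_rescaled_kernel hh hK1, ENNReal.ofReal_one, mul_one]

end RescaledKernel

section LawOfInverse

variable {φ : ℝ → ℝ → ℝ} {I₁ I₂ Θ : Set ℝ} {a b θ : ℝ} {f : ℝ → ℝ} {P : Measure ℝ} {t : ℝ}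

/-- Change of variables under the law `f(e) de` on `I₁`. -/
lemma lintegral_clippedInv_eq (hab : a < b) (hI₁ : IsOpen I₁) (hI₂ : IsOpen I₂)
    (hsub : Icc a b ⊆ Θ) (hθ : θ ∈ Θ) (hA1 : ∀ t ∈ Θ, BijOn (φ t) I₁ I₂ ∧ StrictMonoOn (φ t) I₁)
    (hfc : ContinuousOn f I₁) (hφ : ∀ t ∈ Θ, ContDiffOn ℝ 3 (φ t) I₁)
    (hw : ContDiffOn ℝ 3 (warpInv φ I₁ θ) I₂)
    (hP : P = (volume.restrict I₁).withDensity fun x => ENNReal.ofReal (f x)) (ht : t ∈ Icc a b)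
    {F : ℝ → ENNReal} (hF : Measurable F) :
    ∫⁻ e, F (clippedInv φ I₁ θ a b t e) ∂P =
      ∫⁻ z, ENNReal.ofReal (warpDensity φ I₁ f θ t z) * F z := by
  have hfm : AEMeasurable (fun x => ENNReal.ofReal (f x)) (volume.restrict I₁) :=
    (hfc.aemeasurable hI₁.measurableSet).ennreal_ofReal
  have hm : Measurable fun e => F (clippedInv φ I₁ θ a b t e) :=
    hF.comp (measurable_clippedInv hab hI₁ hsub hθ hA1 t)
  rw [hP, lintegral_withDensity_eq_lintegral_mul₀ hfm hm.aemeasurable,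
    ← lintegral_warpInv_eq hI₁ hI₂ (hA1 θ hθ).1 (hA1 t (hsub ht)).1 (hφ t (hsub ht)) hw]
  refine setLIntegral_congr_fun hI₁.measurableSet fun e he => ?_
  simp only [Pi.mul_apply, clippedInv_eq ht he]

lemma integral_clippedInv_eq (hab : a < b) (hI₁ : IsOpen I₁) (hI₂ : IsOpen I₂)
    (hsub : Icc a b ⊆ Θ) (hθ : θ ∈ Θ) (hA1 : ∀ t ∈ Θ, BijOn (φ t) I₁ I₂ ∧ StrictMonoOn (φ t) I₁)
    (hfc : ContinuousOn f I₁) (hf : ∀ x ∈ I₁, 0 ≤ f x) (hφ : ∀ t ∈ Θ, ContDiffOn ℝ 3 (φ t) I₁)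
    (hw : ContDiffOn ℝ 3 (warpInv φ I₁ θ) I₂)
    (hP : P = (volume.restrict I₁).withDensity fun x => ENNReal.ofReal (f x)) (ht : t ∈ Icc a b)
    {F : ℝ → ℝ} (hF : Measurable F) (hF0 : ∀ z, 0 ≤ F z) :
    ∫ e, F (clippedInv φ I₁ θ a b t e) ∂P = ∫ z, warpDensity φ I₁ f θ t z * F z := by
  have h0 := fun z => warpDensity_nonneg (hA1 θ hθ).1 (hA1 t (hsub ht)).1 hf z
  have hm := measurable_warpDensity hI₁ hI₂ (hA1 θ hθ).1 (hA1 t (hsub ht)).1 hfc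
    (hφ t (hsub ht)) hw
  rw [integral_eq_lintegral_of_nonneg_ae (ae_of_all _ fun e => hF0 _)
      (hF.comp (measurable_clippedInv hab hI₁ hsub hθ hA1 t)).aestronglyMeasurable,
    integral_eq_lintegral_of_nonneg_ae (ae_of_all _ fun z => mul_nonneg (h0 z) (hF0 z))
      (hm.mul hF).aestronglyMeasurable,
    lintegral_clippedInv_eq hab hI₁ hI₂ hsub hθ hA1 hfc hφ hw hP ht hF.ennreal_ofReal]
  simp only [ENNReal.ofReal_mul (h0 _)]

end LawOfInverse

/-! ### Consistency of the parameter estimator and of the density estimator. -/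

lemma criterion_eq_integral_clippedInv {Ω : Type*} [MeasurableSpace Ω] {μ : Measure Ω}
    {φ : ℝ → ℝ → ℝ} {I₁ : Set ℝ} {a b θ t : ℝ} {e : Ω → ℝ} (he : Measurable e)
    (heI : ∀ᵐ ω ∂μ, e ω ∈ I₁) (hm : Measurable (clippedInv φ I₁ θ a b t)) (ht : t ∈ Icc a b) :
    criterion μ φ I₁ θ e t = ∫ x, (clippedInv φ I₁ θ a b t x - x) ^ 2 ∂(μ.map e) := by
  have hm' : Measurable fun x => (clippedInv φ I₁ θ a b t x - x) ^ 2 :=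
    (hm.sub measurable_id).pow_const 2
  rw [integral_map he.aemeasurable hm'.aestronglyMeasurable]
  refine integral_congr_ae ?_
  filter_upwards [heI] with ω hω
  rw [clippedInv_eq ht hω, sq_abs]

lemma sum_Icc_one_eq_sum_range (F : ℕ → ℝ) (n : ℕ) :
    ∑ i ∈ Finset.Icc 1 n, F i = ∑ i ∈ Finset.range n, F (i + 1) := by
  induction n with
  | zero => simp
  | succ n ih => rw [Finset.sum_Icc_succ_top (by omega), ih, Finset.sum_range_succ]

theorem ae_tendsto_thetaHat
    {Ω : Type*} [MeasurableSpace Ω] {μ : Measure Ω} [IsProbabilityMeasure μ]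
    {φ : ℝ → ℝ → ℝ} {I₁ I₂ Θ : Set ℝ} (hI₁ : IsOpen I₁) (hΘ : UniqueDiffOn ℝ Θ)
    {θ a b : ℝ} (hab : a < b) (hsub : Icc a b ⊆ Θ) (hθ : θ ∈ Icc a b)
    {ε : ℕ → Ω → ℝ} (hε : ∀ n, Measurable (ε n)) (hind : iIndepFun ε μ)
    {P : Measure ℝ} (hlaw : ∀ n, μ.map (ε n) = P) (hPI : ∀ᵐ e ∂P, e ∈ I₁)
    (hA1 : ∀ t ∈ Θ, BijOn (φ t) I₁ I₂ ∧ StrictMonoOn (φ t) I₁)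
    (hA2 : ∀ y ∈ I₂, ContDiffOn ℝ 1 (fun t => warpInv φ I₁ t y) Θ)
    (hA4 : ∫⁻ ω, (⨆ t ∈ Icc a b, ‖warpInvDeriv φ I₁ Θ t (φ θ (ε 0 ω))‖ₑ ^ 4) ∂μ < ⊤)
    (hA5 : ∀ t ∈ Icc a b, t ≠ θ →
      0 < (t - θ) * derivWithin (criterion μ φ I₁ θ (ε 0)) Θ t)
    {θ₀ : ℝ} (hθ₀ : θ₀ ∈ Icc a b) {γ : ℕ → ℝ} (hγ : ∀ n, 0 ≤ γ (n + 1))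
    (hγs : Tendsto (fun n => ∑ i ∈ Finset.range n, γ (i + 1)) atTop atTop)
    (hγ2 : Summable fun n => γ (n + 1) ^ 2) :
    ∀ᵐ ω ∂μ, Tendsto (fun n => projIter a b θ₀ γ
      (quadGrad (clippedInv φ I₁ θ a b) (clippedInvDeriv φ I₁ Θ θ a b)) ε n ω) atTop (𝓝 θ) := by
  have hθΘ := hsub hθ
  have hP := isProbabilityMeasure_of_map_eq hε hlaw
  set z := clippedInv φ I₁ θ a b with hz
  set d := clippedInvDeriv φ I₁ Θ θ a b with hd
  have hzm : ∀ t, Measurable (z t) := measurable_clippedInv hab hI₁ hsub hθΘ hA1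
  have hdm : ∀ t, Measurable (d t) := measurable_clippedInvDeriv hab hI₁ hsub hθΘ hA1 hA2
  have hzc : ∀ e, Continuous fun t => z t e := continuous_clippedInv hab hsub hθΘ hA1 hA2
  have hdc : ∀ e, Continuous fun t => d t e := continuous_clippedInvDeriv hab hΘ hsub hθΘ hA1 hA2
  have hder : ∀ e, ∀ t ∈ Icc a b, HasDerivWithinAt (fun s => z s e) (d t e) (Icc a b) t :=
    fun e t ht => hasDerivWithinAt_clippedInv hsub hθΘ hA1 hA2 e ht
  have hSm := measurable_clippedInvDerivSup hab hI₁ hΘ hsub hθΘ hA1 hA2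
  have hSt := clippedInvDerivSup_ne_top hab hΘ hsub hθΘ hA1 hA2
  set S : ℝ → ℝ := fun e => (clippedInvDerivSup φ I₁ Θ θ a b e).toReal with hSdef
  have hSe : ∀ e, ‖S e‖ₑ = clippedInvDerivSup φ I₁ Θ θ a b e := fun e => by
    rw [Real.enorm_of_nonneg ENNReal.toReal_nonneg, ENNReal.ofReal_toReal (hSt e)]
  have hS : ∀ e, ∀ t ∈ Icc a b, |d t e| ≤ S e := by
    intro e t _
    rw [← Real.norm_eq_abs, ← toReal_enorm]
    exact ENNReal.toReal_mono (hSt e) (le_iSup (fun t => ‖d t e‖ₑ) t)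
  have hS4 : ∫⁻ e, ‖S e‖ₑ ^ 4 ∂P ≠ ⊤ := by
    simp only [hSe]
    rw [← hlaw 0, lintegral_map (hSm.pow_const 4) (hε 0)]
    exact ne_top_of_le_ne_top hA4.ne
      (lintegral_mono fun ω => clippedInvDerivSup_pow_four_le hab (ε 0 ω))
  have h0 : ∀ᵐ e ∂P, z θ e = e := by
    filter_upwards [hPI] with e he
    rw [hz, clippedInv_eq hθ he, warpInv_apply (hA1 θ hθΘ).1 he]
  have hH : Measurable (Function.uncurry (quadGrad z d)) :=
    ((measurable_uncurry_of_continuous_of_measurable hdc hdm).const_mul _).mul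
      (measurable_snd.sub (measurable_uncurry_of_continuous_of_measurable hzc hzm))
  have hεI : ∀ᵐ ω ∂μ, ε 0 ω ∈ I₁ := ae_of_ae_map (hε 0).aemeasurable (by rwa [hlaw 0])
  have hm0 : ∀ t ∈ Icc a b, t ≠ θ → 0 < (t - θ) * ∫ e, quadGrad z d t e ∂P := by
    intro t ht hne
    have h1 := hA5 t ht hne
    -- The sign condition itself forces the derivative to be nonzero, hence genuine rather than a
    -- default value. Uniqueness of derivatives within `[a, b]` then identifies it with the mean of
    -- the gradient.
    have h2 : derivWithin (criterion μ φ I₁ θ (ε 0)) Θ t ≠ 0 := fun h => by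
      rw [h, mul_zero] at h1
      exact lt_irrefl _ h1
    have h3 := (differentiableWithinAt_of_derivWithin_ne_zero h2).hasDerivWithinAt.mono hsub
    have hcr : ∀ s ∈ Icc a b, criterion μ φ I₁ θ (ε 0) s = ∫ e, (z s e - e) ^ 2 ∂P :=
      fun s hs => by rw [criterion_eq_integral_clippedInv (hε 0) hεI (hzm s) hs, hlaw 0]
    have h4 := (hasDerivWithinAt_integral_sq_sub hθ hzm hder hS h0 hSm.ennreal_toReal hS4
      ht).congr hcr (hcr t ht)
    rwa [(uniqueDiffOn_Icc hab t ht).eq_deriv _ h3 h4] at h1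
  refine ae_tendsto_robbinsMonro hε hind hlaw hθ hγ hγs hγ2 hH
    (C := (ENNReal.ofReal ((2 * (b - a)) ^ 2) * ∫⁻ e, ‖S e‖ₑ ^ 4 ∂P).toReal)
    ENNReal.toReal_nonneg ?_ ?_ hm0 (measurable_projIter hε hH) (projIter_mem hθ₀)
    fun n ω => rfl
  · intro t ht
    rw [ENNReal.ofReal_toReal (ENNReal.mul_ne_top ENNReal.ofReal_ne_top hS4)]
    exact lintegral_enorm_sq_quadGrad_le hθ hder hS h0 ht
  · exact continuousOn_integral_quadGrad hθ hzm hdm hder hS h0 hSm.ennreal_toReal hS4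
      (fun e => (hzc e).continuousOn) fun e => (hdc e).continuousOn

theorem theorem4p1
    {Ω : Type*} [MeasurableSpace Ω] (μ : Measure Ω) [IsProbabilityMeasure μ]
    -- the deformation family, the parameter interval and the true parameter
    (φ : ℝ → ℝ → ℝ) (I₁ I₂ Θ : Set ℝ) (hI₁ : IsOpen I₁) (hΘ : Θ.OrdConnected)
    (θ a b : ℝ) (ha : a ∈ Θ) (hb : b ∈ Θ) (haθ : a < θ) (hθb : θ < b)
    -- i.i.d. random variables with values in `I₁` and density `f` there
    (ε : ℕ → Ω → ℝ) (f : ℝ → ℝ)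
    (hε_meas : ∀ n, Measurable (ε n)) (hε_indep : iIndepFun ε μ)
    (hf_nonneg : ∀ x ∈ I₁, 0 ≤ f x)
    (hε_law : ∀ n, μ.map (ε n) =
      (volume.restrict I₁).withDensity (fun x => ENNReal.ofReal (f x)))
    -- `φ_t` is an increasing bijection from `I₁` onto `I₂`
    (hA1 : ∀ t ∈ Θ, BijOn (φ t) I₁ I₂ ∧ StrictMonoOn (φ t) I₁)
    -- `φ_t⁻¹(y)` is continuously differentiable in `t`
    (hA2 : ∀ y ∈ I₂, ContDiffOn ℝ 1 (fun t => warpInv φ I₁ t y) Θ)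
    -- square integrability of `φ_t⁻¹ ∘ φ_θ (ε)`
    (hA3 : ∀ t ∈ Θ, MemLp (fun ω => warpInv φ I₁ t (φ θ (ε 0 ω))) 2 μ)
    -- fourth moment of the supremum of the derivative over compact sets
    (hA4 : ∀ B ⊆ Θ, IsCompact B →
      ∫⁻ ω, (⨆ t ∈ B, ‖warpInvDeriv φ I₁ Θ t (φ θ (ε 0 ω))‖ₑ ^ 4) ∂μ < ⊤)
    -- sign condition on the derivative of the criterion
    (hA5 : ∀ t ∈ Icc a b, t ≠ θ →
      0 < (t - θ) * derivWithin (criterion μ φ I₁ θ (ε 0)) Θ t)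
    -- regularity of the density
    (hAD1 : ContDiffOn ℝ 2 f I₁ ∧ ∃ C : ℝ, ∀ x ∈ I₁, ∀ k : ℕ, k ≤ 2 →
      |iteratedDerivWithin k f I₁ x| ≤ C)
    -- regularity of the deformations
    (hAD2 : ∀ t ∈ Θ, ContDiffOn ℝ 3 (φ t) I₁)
    (hAD3 : ContDiffOn ℝ 3 (warpInv φ I₁ θ) I₂ ∧ ∃ C : ℝ, ∀ y ∈ I₂, ∀ k : ℕ, 1 ≤ k → k ≤ 3 →
      |iteratedDerivWithin k (warpInv φ I₁ θ) I₂ y| ≤ C)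
    (hAD4 : ∃ C : ℝ, ∀ t ∈ Θ, ∀ x ∈ I₁, ∀ k : ℕ, 1 ≤ k → k ≤ 3 →
      |iteratedDerivWithin k (φ t) I₁ x| ≤ C)
    -- initial value and steps of the Robbins–Monro algorithm
    (θ₀ : ℝ) (hθ₀ : θ₀ ∈ Icc a b) (γ : ℕ → ℝ)
    (hγ_pos : ∀ n, 1 ≤ n → 0 < γ n) (hγ_anti : ∀ m n, 1 ≤ m → m ≤ n → γ n ≤ γ m)
    (hγ_sum : Tendsto (fun N => ∑ n ∈ Finset.Icc 1 N, γ n) atTop atTop)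
    (hγ_sq : Summable (fun n => γ (n + 1) ^ 2))
    -- the kernel
    (K : ℝ → ℝ) (hK_meas : Measurable K) (hK_nonneg : ∀ u, 0 ≤ K u)
    (hK_symm : ∀ u, K (-u) = K u) (hK_bdd : ∃ C : ℝ, ∀ u, K u ≤ C)
    (hK_int : Integrable K volume) (hK_one : ∫ u, K u = 1)
    (hK_lim : Tendsto (fun u => |u| * K u) (cocompact ℝ) (𝓝 0))
    (hK_sq : Integrable (fun u => u ^ 2 * K u) volume)
    -- the exponent of the bandwidth
    (α : ℝ) (hα0 : 0 < α) (hα1 : α < 1) :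
    ∀ x ∈ I₁, ∀ᵐ ω ∂μ,
      Tendsto (fun n => fHat φ I₁ θ ε (thetaHat φ I₁ Θ θ a b θ₀ γ ε) K α n x ω)
        atTop (𝓝 (f x)) := by
  intro x hx
  have hab : a < b := haθ.trans hθb
  have hθab : θ ∈ Icc a b := ⟨haθ.le, hθb.le⟩
  have hsub : Icc a b ⊆ Θ := hΘ.out ha hb
  have hθ : θ ∈ Θ := hsub hθab
  have hΘu : UniqueDiffOn ℝ Θ := uniqueDiffOn_convex hΘ.convex
    ⟨θ, mem_interior.2 ⟨Ioo a b, Ioo_subset_Icc_self.trans hsub, isOpen_Ioo, haθ, hθb⟩⟩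
  obtain ⟨hb1, hm1⟩ := hA1 θ hθ
  have hI₂ : IsOpen I₂ := by
    rw [← hb1.image_eq]
    exact hm1.isOpen_image_of_continuousOn hI₁ (hAD2 θ hθ).continuousOn
  obtain ⟨hfd, A, hA⟩ := hAD1
  obtain ⟨hw, B, hB⟩ := hAD3
  obtain ⟨D, hD⟩ := hAD4
  obtain ⟨CK, hCK⟩ := hK_bdd
  have hCK0 : 0 ≤ CK := (hK_nonneg 0).trans (hCK 0)
  have hfc := hfd.continuousOn
  have hfA : ∀ x ∈ I₁, f x ≤ A := fun x hx => by
    have := hA x hx 0 (by norm_num)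
    rw [iteratedDerivWithin_zero] at this
    exact (le_abs_self _).trans this
  obtain ⟨P, hP⟩ : ∃ P, P = (volume.restrict I₁).withDensity fun x => ENNReal.ofReal (f x) :=
    ⟨_, rfl⟩
  have hlaw : ∀ n, μ.map (ε n) = P := fun n => (hε_law n).trans hP.symm
  have hPI : ∀ᵐ e ∂P, e ∈ I₁ := by
    rw [hP]
    exact (withDensity_absolutelyContinuous _ _).ae_le (ae_restrict_mem hI₁.measurableSet)
  have hεI : ∀ᵐ ω ∂μ, ∀ n, ε n ω ∈ I₁ := ae_all_iff.2 fun n =>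
    ae_of_ae_map (hε_meas n).aemeasurable (by rwa [hlaw n])
  have hτlim := ae_tendsto_thetaHat hI₁ hΘu hab hsub hθab hε_meas hε_indep hlaw hPI hA1 hA2
    (hA4 _ hsub isCompact_Icc) hA5 hθ₀ (γ := γ) (fun n => (hγ_pos _ (by omega)).le)
    (by simpa only [sum_Icc_one_eq_sum_range] using hγ_sum) hγ_sq
  have hHm : ∀ n, Measurable[Filtration.natural ε (fun n => (hε_meas n).stronglyMeasurable) n]
      (projIter a b θ₀ γ
        (quadGrad (clippedInv φ I₁ θ a b) (clippedInvDeriv φ I₁ Θ θ a b)) ε n) := by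
    refine measurable_projIter hε_meas ?_
    exact ((measurable_uncurry_of_continuous_of_measurable
      (continuous_clippedInvDeriv hab hΘu hsub hθ hA1 hA2)
      (measurable_clippedInvDeriv hab hI₁ hsub hθ hA1 hA2)).const_mul _).mul
      (measurable_snd.sub (measurable_uncurry_of_continuous_of_measurable
        (continuous_clippedInv hab hsub hθ hA1 hA2)
        (measurable_clippedInv hab hI₁ hsub hθ hA1)))
  have hτmem := projIter_mem (γ := γ) (ε := ε)
    (H := quadGrad (clippedInv φ I₁ θ a b) (clippedInvDeriv φ I₁ Θ θ a b)) hθ₀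
  have hτeq := fun ω hω => projIter_eq_thetaHat (φ := φ) (I₁ := I₁) (Θ := Θ) (θ := θ) (γ := γ) (ε := ε)
    hθ₀ (ω := ω) hω
  set τ := projIter a b θ₀ γ
    (quadGrad (clippedInv φ I₁ θ a b) (clippedInvDeriv φ I₁ Θ θ a b)) ε with hτ
  -- Index shift: term `i = n + 1` of the estimator has bandwidth `h n`, parameter `τ n` and
  -- innovation `ε (n + 1)`.
  set h : ℕ → ℝ := fun n => ((n + 1 : ℕ) : ℝ) ^ (-α) with hh
  have hpos : ∀ n, 0 < h n := fun n => Real.rpow_pos_of_pos (by positivity) _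
  have hh0 : Tendsto h atTop (𝓝 0) :=
    ((tendsto_rpow_neg_atTop hα0).comp tendsto_natCast_atTop_atTop).comp (tendsto_add_atTop_nat 1)
  have hρB : ∀ t ∈ Icc a b, ∀ z, warpDensity φ I₁ f θ t z ≤ |B| * |D| * |A| := fun t ht =>
    warpDensity_le hb1 (hA1 t (hsub ht)).1 hf_nonneg hfA
      (fun y hy => ((hasDerivAt_and_bounds_of_contDiffOn hI₂ hw hB).1 y hy).2)
      (fun y hy => ((hasDerivAt_and_bounds_of_contDiffOn hI₁ (hAD2 t (hsub ht))
        (hD t (hsub ht))).1 y hy).2)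
  have hkm : ∀ n, Measurable fun z => 1 / h n * K ((x - z) / h n) := fun n =>
    (hK_meas.comp ((measurable_const.sub measurable_id).div_const _)).const_mul _
  have hk0 : ∀ n z, 0 ≤ 1 / h n * K ((x - z) / h n) := fun n z =>
    mul_nonneg (one_div_nonneg.2 (hpos n).le) (hK_nonneg _)
  have hzu : Measurable (Function.uncurry (clippedInv φ I₁ θ a b)) :=
    measurable_uncurry_of_continuous_of_measurable (continuous_clippedInv hab hsub hθ hA1 hA2)
      (measurable_clippedInv hab hI₁ hsub hθ hA1)
  have havg := ae_tendsto_average_of_drift hε_meas hε_indep hlaw hHm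
    (g := fun n t e => 1 / h n * K ((x - clippedInv φ I₁ θ a b t e) / h n))
    (fun n => (hkm n).comp hzu)
    (c := fun n => |B| * |D| * |A| * (CK / h n))
    (fun n => mul_nonneg (by positivity) (div_nonneg hCK0 (hpos n).le)) ?_ ?_ (l := f x) ?_
  · filter_upwards [havg, hεI] with ω hω hωI
    refine hω.congr fun n => ?_
    rw [fHat, sum_Icc_one_eq_sum_range, one_div]
    congr 1
    refine Finset.sum_congr rfl fun i _ => ?_
    rw [Nat.add_sub_cancel, clippedInv_eq (hτmem i ω) (hωI _), hτeq ω hωI]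
  -- Since `1 / h n = (n + 1) ^ α`, the variance series has exponent `α - 2 < -1`; this is where `α
  -- < 1` enters.
  · have h1 : Summable fun n : ℕ => ((n + 1 : ℕ) : ℝ) ^ (α - 2) :=
      (summable_nat_add_iff 1).2 (Real.summable_nat_rpow.2 (by linarith))
    refine (h1.mul_left (|B| * |D| * |A| * CK)).congr fun n => ?_
    have hn : (0 : ℝ) < ((n + 1 : ℕ) : ℝ) := by positivity
    rw [hh]
    simp only [Real.rpow_neg hn.le, Real.rpow_sub hn, Real.rpow_two, div_inv_eq_mul]
    push_cast
    ring
  · intro n ω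
    rw [lintegral_clippedInv_eq hab hI₁ hI₂ hsub hθ hA1 hfc hAD2 hw hP (hτmem n ω)
      (F := fun z => ‖1 / h n * K ((x - z) / h n)‖ₑ ^ 2) ((hkm n).enorm.pow_const 2),
      ENNReal.ofReal_mul (by positivity)]
    calc _ ≤ ∫⁻ z, ENNReal.ofReal (|B| * |D| * |A|) * ‖1 / h n * K ((x - z) / h n)‖ₑ ^ 2 := by
          refine lintegral_mono fun z => ?_
          gcongr
          exact hρB _ (hτmem n ω) z
      _ ≤ _ := by
          rw [lintegral_const_mul' _ _ ENNReal.ofReal_ne_top]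
          gcongr
          exact lintegral_rescaled_kernel_sq_le (hpos n) hK_int hK_nonneg hK_one hCK
  -- For fixed `ω` the conditional means are kernel smoothings of deterministic densities whose
  -- parameters tend to `θ`.
  · filter_upwards [hτlim] with ω hω
    have h1 : ∀ n, ∫ e, 1 / h n * K ((x - clippedInv φ I₁ θ a b (τ n ω) e) / h n) ∂P =
        ∫ z, warpDensity φ I₁ f θ (τ n ω) z * (1 / h n * K ((x - z) / h n)) := fun n =>
      integral_clippedInv_eq hab hI₁ hI₂ hsub hθ hA1 hfc hf_nonneg hAD2 hw hP (hτmem n ω)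
        (hkm n) (hk0 n)
    simp only [h1]
    refine tendsto_integral_rescaled_kernel hK_int hK_one (fun n => ?_) (B := |B| * |D| * |A|)
      (fun n z => ?_) hpos hh0 fun z hz => ?_
    · exact measurable_warpDensity hI₁ hI₂ hb1 (hA1 _ (hsub (hτmem n ω))).1 hfc
        (hAD2 _ (hsub (hτmem n ω))) hw
    · rw [abs_of_nonneg (warpDensity_nonneg hb1 (hA1 _ (hsub (hτmem n ω))).1 hf_nonneg z)]
      exact hρB _ (hτmem n ω) z
    · exact tendsto_warpDensity hI₁ hI₂ hA1 (fun y hy => (hA2 y hy).continuousOn) hθ hx hfc hAD2 hw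
        hD (fun n => hsub (hτmem n ω)) hω hz
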